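/- Let $G$ be a finite simple graph with vertex set $V$, $|V|\ge 3$, that is unicyclic, i.e. connected and containing exactly one cycle; let $\overline{G}$ be its complement. For a graph $H$ on $V$, let $d_H(x,y)$ be the least number of edges of a path between $x$ and $y$ in $H$, and $d_H(x,y)=\infty$ if there is none. A function $g:V\to[0,1]$ is a resolving function of $H$ if $\sum_{z\in V:\ d_H(x,z)\ne d_H(y,z)} g(z)\ge 1$ for all distinct $x,y\in V$. Let $\dim_f(H)$ be the minimum of $\sum_{v\in V} g(v)$ over all resolving functions $g$ of $H$, and let $\mathrm{Sd}_f(G,\overline{G})$ be the minimum of $\sum_{v\in V} g(v)$ over all $g$ that are resolving functions of both $G$ and $\overline{G}$. Let $H_1$ be the graph obtained from $K_1\cup C_3$ by joining the vertex of $K_1$ to a vertex of $C_3$ by an edge, let $H_2$ be the graph obtained from $K_1\cup C_4$ by joining the vertex of $K_1$ to a vertex of $C_4$ by an edge, and let $H_3$ be the graph obtained from the path $P_6$ by joining by an edge its two support vertices (the neighbours of its two end-vertices). Then, up to isomorphism of $G$, $$\mathrm{Sd}_f(G,\overline{G})=\begin{cases}\dim_f(G)=\dim_f(\overline{G})+\frac12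 & \text{if } G\in\{H_1,H_2\},\\ \dim_f(G)=\dim_f(\overline{G})+\frac13 & \text{if } G=H_3,\\ \dim_f(\overline{G}) & \text{otherwise.}\end{cases}$$ -/

import Mathlib

namespace FracDim

/-- A unicyclic graph: a connected graph that contains exactly one cycle
(cycles being compared as subgraphs, so that starting point and orientation do not matter). -/
def IsUnicyclic {V : Type*} (G : SimpleGraph V) : Prop :=
  G.Connected ∧ ∃! C : G.Subgraph, ∃ (v : V) (c : G.Walk v v), c.IsCycle ∧ c.toSubgraph = C

section

variable {V : Type*} [Fintype V]

open Classical in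
/-- The set `R_G{x, y}` of the vertices `z` with `d_G(x, z) ≠ d_G(y, z)`. The distance takes the
value `⊤` on pairs of vertices that are not linked by a path. -/
noncomputable def resolvers (G : SimpleGraph V) (x y : V) : Finset V :=
  Finset.univ.filter fun z => G.edist x z ≠ G.edist y z

/-- `g : V → [0, 1]` is a resolving function of `G`. -/
def IsResolvingFunction (G : SimpleGraph V) (g : V → ℝ) : Prop :=
  (∀ v, g v ∈ Set.Icc (0 : ℝ) 1) ∧ ∀ x y : V, x ≠ y → 1 ≤ ∑ z ∈ resolvers G x y, g z

/-- `g` is a simultaneous resolving function of a family `𝒞` of graphs on the vertex set `V`. -/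
def IsSimResolvingFunction (𝒞 : Set (SimpleGraph V)) (g : V → ℝ) : Prop :=
  ∀ G ∈ 𝒞, IsResolvingFunction G g

/-- The fractional dimension `dim_f(G)`; the infimum is a minimum, see `dimf_isLeast`. -/
noncomputable def dimf (G : SimpleGraph V) : ℝ :=
  sInf {r : ℝ | ∃ g : V → ℝ, IsResolvingFunction G g ∧ ∑ v, g v = r}

/-- The simultaneous fractional dimension `Sd_f(𝒞)` of a (nonempty) family of graphs; the infimum
is a minimum, see `Sdf_isLeast`. -/
noncomputable def Sdf (𝒞 : Set (SimpleGraph V)) : ℝ :=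
  sInf {r : ℝ | ∃ g : V → ℝ, IsSimResolvingFunction 𝒞 g ∧ ∑ v, g v = r}

theorem isResolvingFunction_one (G : SimpleGraph V) : IsResolvingFunction G fun _ => 1 := by
  classical
  refine ⟨fun v => by simp, fun x y hxy => ?_⟩
  have hx : x ∈ resolvers G x y := by
    simp only [resolvers, Finset.mem_filter, Finset.mem_univ, true_and, SimpleGraph.edist_self]
    intro h
    exact hxy (SimpleGraph.edist_eq_zero_iff.mp h.symm).symm
  exact Finset.single_le_sum (f := fun _ => (1 : ℝ)) (fun _ _ => zero_le_one) hx

theorem isClosed_isResolvingFunction (G : SimpleGraph V) :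
    IsClosed {g : V → ℝ | IsResolvingFunction G g} := by
  simp only [IsResolvingFunction, Set.ofPred_and, Set.ofPred_forall]
  refine IsClosed.inter (isClosed_iInter fun v => ?_)
    (isClosed_iInter fun x => isClosed_iInter fun y => isClosed_iInter fun _ => ?_)
  · exact isClosed_Icc.preimage (continuous_apply v)
  · exact isClosed_le continuous_const (by fun_prop)

/-- The minimum that defines `Sd_f` exists. -/
theorem Sdf_isLeast {𝒞 : Set (SimpleGraph V)} (h : 𝒞.Nonempty) :
    IsLeast {r : ℝ | ∃ g : V → ℝ, IsSimResolvingFunction 𝒞 g ∧ ∑ v, g v = r} (Sdf 𝒞) := by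
  obtain ⟨G, hG⟩ := h
  have hc : IsClosed {g : V → ℝ | IsSimResolvingFunction 𝒞 g} := by
    simp only [IsSimResolvingFunction, Set.ofPred_forall]
    exact isClosed_iInter fun H => isClosed_iInter fun _ => isClosed_isResolvingFunction H
  have hK : IsCompact {g : V → ℝ | IsSimResolvingFunction 𝒞 g} :=
    (isCompact_univ_pi fun _ : V => isCompact_Icc (a := (0 : ℝ)) (b := 1)).of_isClosed_subset hc
      fun g hg v _ => (hg G hG).1 v
  have hf : Continuous fun g : V → ℝ => ∑ v, g v := by fun_prop
  exact (hK.image hf).isLeast_sInf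
    ⟨_, Set.mem_image_of_mem _ (show IsSimResolvingFunction 𝒞 fun _ => 1 from
      fun H _ => isResolvingFunction_one H)⟩

/-- The minimum that defines `dim_f` exists. -/
theorem dimf_isLeast (G : SimpleGraph V) :
    IsLeast {r : ℝ | ∃ g : V → ℝ, IsResolvingFunction G g ∧ ∑ v, g v = r} (dimf G) := by
  have h := Sdf_isLeast (Set.singleton_nonempty G)
  simpa only [Sdf, dimf, IsSimResolvingFunction, Set.mem_singleton_iff, forall_eq] using h

end

/-- The triangle `0, 1, 2` with a pendant vertex `3` attached to `0`. -/
def H₁ : SimpleGraph (Fin 4) :=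
  SimpleGraph.fromEdgeSet {s(0, 1), s(1, 2), s(2, 0), s(0, 3)}

/-- The 4-cycle `0, 1, 2, 3` with a pendant vertex `4` attached to `0`. -/
def H₂ : SimpleGraph (Fin 5) :=
  SimpleGraph.fromEdgeSet {s(0, 1), s(1, 2), s(2, 3), s(3, 0), s(0, 4)}

/-- The path `0, 1, 2, 3, 4, 5` with its two support vertices `1` and `4` joined by an edge. -/
def H₃ : SimpleGraph (Fin 6) :=
  SimpleGraph.fromEdgeSet {s(0, 1), s(1, 2), s(2, 3), s(3, 4), s(4, 5), s(1, 4)}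

end FracDim

/-! Call $t$ an adjacency separator of $u,v$ (`AdjSep`) if $t$ is one of them or is adjacent to
exactly one of them. This relation is the same for $G$ and $\overline G$, and it implies unequal
distances in both graphs. Hence a function giving weight at least 1 to every set of adjacency
separators resolves both graphs, and $\mathrm{Sd}_f(G,\overline G)=\dim_f(\overline G)$ follows once
an optimal function of $\overline G$ can be turned into such a function without increasing its
total.

In $\overline G$ the ends $u,t$ of an edge of $G$ are at distance 2 unless that edge dominates $G$.
So a vertex $t$ resolves $u,v$ in $\overline G$ without separating them by adjacency only if it is
adjacent in $G$ to both and $ut$ or $vt$ is a dominating edge (`adjSep_or_of_edist_compl_ne`).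
Without dominating edges nothing has to be changed.

If $xz$ dominates, having only one cycle forces that cycle to be a triangle or a 4-cycle, and every
vertex off the cycle and the edge to be a pendant at $x$ or $z$. In these families the surplus
weight, sitting on $x$ or $z$, is moved by a map $\sigma$ to vertices that do separate by adjacency
(`Transfers.Sdf_eq`). Pairs of twins help: in $\overline G$ only the twins themselves resolve them,
so together they carry weight at least 1. The method leaves out exactly $H_1,H_2,H_3$, which are
finite linear programs solved by explicit weights and matching sums of constraints. -/

namespace FracDim

/-! ### Separation by adjacency and distances in the complement -/

section

variable {V : Type*}

/-- `t` separates `u` and `v` by equality or adjacency. -/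
def AdjSep (G : SimpleGraph V) (u v t : V) : Prop :=
  t = u ∨ t = v ∨ ¬(G.Adj u t ↔ G.Adj v t)

/-- Every vertex is equal or adjacent to one of `a`, `b`. -/
def Dominates (G : SimpleGraph V) (a b : V) : Prop :=
  ∀ s, s ≠ a → s ≠ b → G.Adj a s ∨ G.Adj b s

theorem adjSep_compl {G : SimpleGraph V} {u v t : V} : AdjSep Gᶜ u v t ↔ AdjSep G u v t := by
  simp only [AdjSep, SimpleGraph.compl_adj]
  grind

theorem AdjSep.edist_ne {G : SimpleGraph V} {u v t : V} (h : AdjSep G u v t) (huv : u ≠ v) :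
    G.edist u t ≠ G.edist v t := by
  rcases h with rfl | rfl | h
  · rw [SimpleGraph.edist_self]
    exact fun h => huv (SimpleGraph.edist_eq_zero_iff.mp h.symm).symm
  · rw [SimpleGraph.edist_self]
    exact fun h => huv (SimpleGraph.edist_eq_zero_iff.mp h)
  · intro he
    rw [← SimpleGraph.edist_eq_one_iff_adj, ← SimpleGraph.edist_eq_one_iff_adj, he] at h
    exact h Iff.rfl

/-- A vertex missed by the edge is a common neighbour of its ends in the complement. -/
theorem edist_compl_eq_two {G : SimpleGraph V} {u t : V} (h : G.Adj u t)
    (hd : ¬Dominates G u t) : Gᶜ.edist u t = 2 := by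
  rw [SimpleGraph.edist_eq_two_iff]
  refine ⟨h.ne, by simp [h], ?_⟩
  simp only [Dominates, not_forall, not_or] at hd
  obtain ⟨s, hs, hs', h1, h2⟩ := hd
  exact ⟨s, by simp [SimpleGraph.mem_commonNeighbors, h1, h2, hs.symm, hs'.symm]⟩

theorem adjSep_or_of_edist_compl_ne {G : SimpleGraph V} {u v t : V}
    (h : Gᶜ.edist u t ≠ Gᶜ.edist v t) :
    AdjSep G u v t ∨ (G.Adj u t ∧ G.Adj v t ∧ (Dominates G u t ∨ Dominates G v t)) := by
  by_contra! hc
  obtain ⟨h1, h2⟩ := hc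
  simp only [AdjSep, not_or, not_not] at h1
  obtain ⟨hu, hv, hi⟩ := h1
  by_cases ha : G.Adj u t
  · obtain ⟨h3, h4⟩ := h2 ha (hi.mp ha)
    exact h (by rw [edist_compl_eq_two ha h3, edist_compl_eq_two (hi.mp ha) h4])
  · have h3 : Gᶜ.Adj u t := by simp [ha, Ne.symm hu]
    have h4 : Gᶜ.Adj v t := by simp [← hi, ha, Ne.symm hv]
    exact h (by rw [SimpleGraph.edist_eq_one_iff_adj.mpr h3,
      SimpleGraph.edist_eq_one_iff_adj.mpr h4])

theorem edist_map_le {W : Type*} {G : SimpleGraph V} {H : SimpleGraph W} (f : G →g H) (u v : V) :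
    H.edist (f u) (f v) ≤ G.edist u v := by
  by_cases h : G.edist u v = ⊤
  · simp [h]
  · obtain ⟨p, hp⟩ := SimpleGraph.exists_walk_of_edist_ne_top h
    rw [← hp, ← SimpleGraph.Walk.length_map f p]
    exact SimpleGraph.edist_le _

theorem edist_iso {W : Type*} {G : SimpleGraph V} {H : SimpleGraph W} (e : G ≃g H) (u v : V) :
    H.edist (e u) (e v) = G.edist u v := by
  refine le_antisymm (edist_map_le e.toHom u v) ?_
  simpa using edist_map_le e.symm.toHom (e u) (e v)

/-- Exchanging the twins `u` and `v` is an automorphism of the complement that fixes every other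
`t`. -/
theorem eq_or_eq_of_twins {G : SimpleGraph V} {u v t : V}
    (h : ∀ s, AdjSep G u v s → s = u ∨ s = v) (ht : Gᶜ.edist u t ≠ Gᶜ.edist v t) :
    t = u ∨ t = v := by
  classical
  by_contra! hc
  have h' : ∀ s, s ≠ u → s ≠ v → (G.Adj u s ↔ G.Adj v s) := by
    intro s h1 h2
    by_contra h3
    exact (h s (Or.inr (Or.inr h3))).elim h1 h2
  let e : Gᶜ ≃g Gᶜ := ⟨Equiv.swap u v, by
    intro a b
    simp only [SimpleGraph.compl_adj, Equiv.swap_apply_def]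
    have := G.adj_comm
    have : ∀ x, ¬G.Adj x x := fun x => G.irrefl
    grind⟩
  have h1 := edist_iso e u t
  have e1 : e u = v := Equiv.swap_apply_left u v
  have e2 : e t = t := Equiv.swap_apply_of_ne_of_ne hc.1 hc.2
  rw [e1, e2] at h1
  exact ht h1.symm

end

/-! ### Transfer of weights and invariance under isomorphism -/

section

variable {V : Type*} [Fintype V]

theorem mem_resolvers {G : SimpleGraph V} {x y z : V} :
    z ∈ resolvers G x y ↔ G.edist x z ≠ G.edist y z := by
  simp [resolvers]

/-- There is a self-map `σ` of the vertex set along which weights can be pushed forward, turning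
resolving functions of the complement into functions that resolve by adjacency. -/
def Transfers (G : SimpleGraph V) : Prop :=
  ∃ σ : V → V, ∀ u v, u ≠ v → ∃ u' v', u' ≠ v' ∧
    ∀ t, Gᶜ.edist u' t ≠ Gᶜ.edist v' t → AdjSep G u v (σ t)

theorem dimf_le {G : SimpleGraph V} {g : V → ℝ} (hg : IsResolvingFunction G g) :
    dimf G ≤ ∑ v, g v :=
  (dimf_isLeast G).2 ⟨g, hg, rfl⟩

theorem Sdf_pair_le {G H : SimpleGraph V} {g : V → ℝ} (hG : IsResolvingFunction G g)
    (hH : IsResolvingFunction H g) : Sdf {G, H} ≤ ∑ v, g v :=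
  (Sdf_isLeast ⟨G, by simp⟩).2 ⟨g, by rintro K (rfl | rfl) <;> assumption, rfl⟩

theorem dimf_le_Sdf_of_mem {𝒞 : Set (SimpleGraph V)} {G : SimpleGraph V} (h : G ∈ 𝒞) :
    dimf G ≤ Sdf 𝒞 := by
  obtain ⟨g, hg, he⟩ := (Sdf_isLeast ⟨G, h⟩).1
  exact he ▸ dimf_le (hg G h)

/-- An optimal `g` for the complement is pushed forward along `σ`. The weight received by the
separators of `u`, `v` is the `g`-weight of their preimage, which contains all resolvers of `u'`,
`v'` in the complement and so weighs at least 1. -/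
theorem Transfers.Sdf_eq {G : SimpleGraph V} (h : Transfers G) :
    Sdf {G, Gᶜ} = dimf Gᶜ := by
  classical
  refine le_antisymm ?_ (dimf_le_Sdf_of_mem (by simp))
  obtain ⟨g, ⟨hg, hr⟩, he⟩ := (dimf_isLeast Gᶜ).1
  obtain ⟨σ, hσ⟩ := h
  have hg0 : ∀ v, 0 ≤ g v := fun v => (hg v).1
  let f : V → ℝ := fun t => ∑ s with σ s = t, g s
  have hf0 : ∀ t, 0 ≤ f t := fun t => Finset.sum_nonneg fun s _ => hg0 s
  -- Truncation keeps the values in [0, 1]. It is harmless: a separator whose weight was cut down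
  -- has weight 1 and satisfies its constraints alone.
  let g' : V → ℝ := fun t => min 1 (f t)
  have hg' : ∀ t, g' t ∈ Set.Icc (0 : ℝ) 1 := fun t =>
    ⟨le_min zero_le_one (hf0 t), min_le_left _ _⟩
  have hadj : ∀ u v, u ≠ v → 1 ≤ ∑ t with AdjSep G u v t, g' t := by
    intro u v huv
    by_cases hex : ∃ t, AdjSep G u v t ∧ 1 ≤ f t
    · obtain ⟨t, ht, h1⟩ := hex
      have : g' t = 1 := min_eq_left h1
      rw [← this]
      exact Finset.single_le_sum (fun s _ => (hg' s).1) (by simpa using ht)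
    · push Not at hex
      obtain ⟨u', v', hne, hs⟩ := hσ u v huv
      have h1 : ∑ t with AdjSep G u v t, g' t = ∑ t with AdjSep G u v t, f t :=
        Finset.sum_congr rfl fun t ht => min_eq_right (hex t (by simpa using ht)).le
      have h2 : ∑ t with AdjSep G u v t, f t = ∑ s with AdjSep G u v (σ s), g s := by
        rw [← Finset.sum_fiberwise_of_maps_to (s := Finset.univ.filter fun s => AdjSep G u v (σ s))
          (t := Finset.univ.filter fun t => AdjSep G u v t) (g := σ) (by simp)]
        refine Finset.sum_congr rfl fun t ht => ?_
        have ht' : AdjSep G u v t := by simpa using ht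
        refine Finset.sum_congr ?_ fun _ _ => rfl
        ext s
        simp only [Finset.mem_filter, Finset.mem_univ, true_and]
        exact ⟨fun h => ⟨h ▸ ht', h⟩, fun h => h.2⟩
      rw [h1, h2]
      refine (hr u' v' hne).trans (Finset.sum_le_sum_of_subset_of_nonneg ?_ fun s _ _ => hg0 s)
      intro t ht
      simpa using hs t (mem_resolvers.mp ht)
  have key : ∀ H : SimpleGraph V, (∀ u v t, AdjSep G u v t → AdjSep H u v t) →
      IsResolvingFunction H g' := by
    refine fun H hH => ⟨hg', fun u v huv => (hadj u v huv).trans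
      (Finset.sum_le_sum_of_subset_of_nonneg ?_ fun s _ _ => (hg' s).1)⟩
    intro t ht
    exact mem_resolvers.mpr ((hH u v t (by simpa using ht)).edist_ne huv)
  refine (Sdf_pair_le (key G fun _ _ _ h => h) (key Gᶜ fun _ _ _ h => adjSep_compl.mpr h)).trans ?_
  rw [← he]
  calc ∑ t, g' t ≤ ∑ t, f t := Finset.sum_le_sum fun t _ => min_le_right _ _
    _ = ∑ s, g s := Finset.sum_fiberwise _ _ _

theorem IsResolvingFunction.comp_iso {W : Type*} [Fintype W] {G : SimpleGraph V}
    {H : SimpleGraph W} (e : G ≃g H) {g : W → ℝ} (hg : IsResolvingFunction H g) :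
    IsResolvingFunction G (g ∘ e) := by
  classical
  refine ⟨fun v => hg.1 _, fun x y hxy => ?_⟩
  refine (hg.2 (e x) (e y) (e.injective.ne hxy)).trans (le_of_eq ?_)
  symm
  refine Finset.sum_equiv e.toEquiv (fun z => ?_) fun z _ => rfl
  rw [mem_resolvers, mem_resolvers, ← edist_iso e, ← edist_iso e]
  rfl

theorem dimf_le_of_iso {W : Type*} [Fintype W] {G : SimpleGraph V}
    {H : SimpleGraph W} (e : G ≃g H) : dimf G ≤ dimf H := by
  obtain ⟨g, hg, he⟩ := (dimf_isLeast H).1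
  rw [← he, ← Equiv.sum_comp e.toEquiv g]
  exact dimf_le (hg.comp_iso e)

theorem dimf_iso {W : Type*} [Fintype W] {G : SimpleGraph V}
    {H : SimpleGraph W} (e : G ≃g H) : dimf G = dimf H :=
  le_antisymm (dimf_le_of_iso e) (dimf_le_of_iso e.symm)

/-- An isomorphism of graphs is an isomorphism of their complements. -/
def complIso {W : Type*} {G : SimpleGraph V} {H : SimpleGraph W} (e : G ≃g H) : Gᶜ ≃g Hᶜ :=
  ⟨e.toEquiv, by
    intro a b
    change Hᶜ.Adj (e a) (e b) ↔ _
    rw [SimpleGraph.compl_adj, SimpleGraph.compl_adj, e.map_adj_iff, e.injective.ne_iff]⟩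

theorem Sdf_compl_le_of_iso {W : Type*} [Fintype W] {G : SimpleGraph V}
    {H : SimpleGraph W} (e : G ≃g H) : Sdf {G, Gᶜ} ≤ Sdf {H, Hᶜ} := by
  obtain ⟨g, hg, he⟩ := (Sdf_isLeast (𝒞 := {H, Hᶜ}) ⟨H, by simp⟩).1
  rw [← he, ← Equiv.sum_comp e.toEquiv g]
  exact Sdf_pair_le ((hg H (by simp)).comp_iso e) ((hg Hᶜ (by simp)).comp_iso (complIso e))

theorem Sdf_compl_iso {W : Type*} [Fintype W] {G : SimpleGraph V}
    {H : SimpleGraph W} (e : G ≃g H) : Sdf {G, Gᶜ} = Sdf {H, Hᶜ} :=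
  le_antisymm (Sdf_compl_le_of_iso e) (Sdf_compl_le_of_iso e.symm)

end

/-! ### The vertex set of the unique cycle -/

section

variable {V : Type*}

/-- All that the classification uses of unicyclicity: every triangle and every 4-cycle has vertex
set `S`, and each vertex of `S` has two neighbours in `S`. -/
theorem IsUnicyclic.exists_cycle_verts {G : SimpleGraph V} (hG : IsUnicyclic G) :
    ∃ S : V → Prop,
      (∀ a b c, G.Adj a b → G.Adj b c → G.Adj c a → ∀ v, S v ↔ v = a ∨ v = b ∨ v = c) ∧
      (∀ a b c d, G.Adj a b → G.Adj b c → G.Adj c d → G.Adj d a → a ≠ c → b ≠ d →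
        ∀ v, S v ↔ v = a ∨ v = b ∨ v = c ∨ v = d) ∧
      (∃ v, S v) ∧
      ∀ v, S v → ∃ a b, S a ∧ S b ∧ a ≠ b ∧ G.Adj v a ∧ G.Adj v b := by
  obtain ⟨-, C, ⟨w, p, hp, rfl⟩, hu⟩ := hG
  refine ⟨fun v => v ∈ p.toSubgraph.verts, ?_, ?_, ⟨w, by simp⟩, ?_⟩
  · intro a b c hab hbc hca v
    have := hu _ ⟨a, .cons hab (.cons hbc (.cons hca .nil)), ?_, rfl⟩
    · rw [← this]
      simp
      grind
    · simp [SimpleGraph.Walk.isCycle_def, hab.ne, hbc.ne, hca.ne, hab.ne', hca.ne']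
  · intro a b c d hab hbc hcd hda hac hbd v
    have := hu _ ⟨a, .cons hab (.cons hbc (.cons hcd (.cons hda .nil))), ?_, rfl⟩
    · rw [← this]
      simp
      grind
    · simp [SimpleGraph.Walk.isCycle_def, hab.ne, hbc.ne, hcd.ne, hda.ne, hab.ne',
        hda.ne', hac, hac.symm, hbd]
  · intro v hv
    have h2 := hp.ncard_neighborSet_toSubgraph_eq_two (p.mem_verts_toSubgraph.mp hv)
    obtain ⟨a, b, hab, h⟩ := Set.ncard_eq_two.mp h2
    have ha : p.toSubgraph.Adj v a := by
      rw [← SimpleGraph.Subgraph.mem_neighborSet, h]; simp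
    have hb : p.toSubgraph.Adj v b := by
      rw [← SimpleGraph.Subgraph.mem_neighborSet, h]; simp
    exact ⟨a, b, ha.snd_mem, hb.snd_mem, hab, ha.adj_sub, hb.adj_sub⟩

end

/-! ### Decidable distances -/

section

variable {V : Type*}

/-- There is a walk of length at most `k` from `u` to `v`. -/
def WithinDist (G : SimpleGraph V) : ℕ → V → V → Prop
  | 0, u, v => u = v
  | k + 1, u, v => u = v ∨ ∃ w, G.Adj u w ∧ WithinDist G k w v

instance WithinDist.decidable [Fintype V] [DecidableEq V] (G : SimpleGraph V) [DecidableRel G.Adj] :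
    ∀ k u v, Decidable (WithinDist G k u v)
  | 0, u, v => inferInstanceAs (Decidable (u = v))
  | k + 1, u, v =>
    haveI := WithinDist.decidable G k
    inferInstanceAs (Decidable (u = v ∨ ∃ w, G.Adj u w ∧ WithinDist G k w v))

theorem edist_le_iff_withinDist (G : SimpleGraph V) (k : ℕ) (u v : V) :
    G.edist u v ≤ k ↔ WithinDist G k u v := by
  constructor
  · intro h
    obtain ⟨p, hp⟩ := SimpleGraph.exists_walk_of_edist_ne_top (ne_top_of_le_ne_top (by simp) h)
    rw [← hp, Nat.cast_le] at h
    clear hp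
    induction p generalizing k with
    | nil => cases k <;> simp [WithinDist]
    | cons ha q ih =>
      cases k with
      | zero => simp at h
      | succ k => exact Or.inr ⟨_, ha, ih k (by simpa using h)⟩
  · intro h
    suffices ∃ p : G.Walk u v, p.length ≤ k by
      obtain ⟨p, hp⟩ := this
      exact (SimpleGraph.edist_le p).trans (by exact_mod_cast hp)
    induction k generalizing u with
    | zero => obtain rfl := h; exact ⟨.nil, le_rfl⟩
    | succ k ih =>
      rcases h with rfl | ⟨w, ha, hw⟩
      · exact ⟨.nil, by simp⟩
      · obtain ⟨p, hp⟩ := ih w hw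
        exact ⟨.cons ha p, by simpa using hp⟩

/-- By `hn` balls stop growing at radius `n`, so every finite distance is at most `n`. Two
distances, possibly infinite, then agree as soon as they pass the same tests at radii 0 to `n`. -/
theorem resolvers_eq_filter_withinDist [Fintype V] [DecidableEq V] (G : SimpleGraph V) [DecidableRel G.Adj]
    (n : ℕ) (hn : ∀ u v, WithinDist G (n + 1) u v → WithinDist G n u v) (x y : V) :
    resolvers G x y = Finset.univ.filter fun z =>
      ∃ k : Fin (n + 1), ¬(WithinDist G k x z ↔ WithinDist G k y z) := by
  have hstab : ∀ m u v, WithinDist G (n + m) u v → WithinDist G n u v := by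
    intro m
    induction m with
    | zero => exact fun _ _ h => h
    | succ m ih =>
      rintro u v (rfl | ⟨w, ha, hw⟩)
      · exact (edist_le_iff_withinDist G n u u).mp (by simp)
      · exact hn _ _ (Or.inr ⟨w, ha, ih w v hw⟩)
  have hle : ∀ u v (m : ℕ), G.edist u v ≤ m → G.edist u v ≤ n := by
    intro u v m h
    refine (edist_le_iff_withinDist G n u v).mpr (hstab m u v ?_)
    rw [← edist_le_iff_withinDist]
    exact h.trans (by exact_mod_cast Nat.le_add_left m n)
  ext z
  simp only [mem_resolvers, Finset.mem_filter, Finset.mem_univ, true_and]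
  constructor
  · intro h
    by_contra! hc
    have hc' : ∀ k : ℕ, k ≤ n → (G.edist x z ≤ k ↔ G.edist y z ≤ k) := fun k hk => by
      rw [edist_le_iff_withinDist, edist_le_iff_withinDist]
      exact hc ⟨k, Nat.lt_succ_of_le hk⟩
    have aux : ∀ a b, (∀ k : ℕ, k ≤ n → (G.edist a z ≤ k ↔ G.edist b z ≤ k)) →
        G.edist b z ≤ G.edist a z := by
      intro a b hab
      by_cases ht : G.edist a z = ⊤
      · simp [ht]
      · obtain ⟨m, hm⟩ := ENat.ne_top_iff_exists.mp ht
        have : m ≤ n := by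
          have := hle a z m hm.ge
          rw [← hm] at this
          exact_mod_cast this
        rw [← hm]
        exact (hab m this).mp hm.ge
    exact h (le_antisymm (aux y x fun k hk => (hc' k hk).symm) (aux x y hc'))
  · rintro ⟨k, hk⟩ he
    rw [← edist_le_iff_withinDist, ← edist_le_iff_withinDist, he] at hk
    exact hk Iff.rfl

/-- Integer numerators over a common denominator `N` turn the constraints into statements about
natural numbers that `decide` can settle. -/
theorem isResolvingFunction_of_weights [Fintype V] [DecidableEq V] (G : SimpleGraph V)
    [DecidableRel G.Adj] (n : ℕ) (hn : ∀ u v, WithinDist G (n + 1) u v → WithinDist G n u v)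
    (N : ℕ) (hN : 0 < N) (w : V → ℕ) (hw : ∀ v, w v ≤ N)
    (h : ∀ x y, x ≠ y → N ≤ ∑ z with ∃ k : Fin (n + 1),
      ¬(WithinDist G k x z ↔ WithinDist G k y z), w z) :
    IsResolvingFunction G fun v => (w v : ℝ) / N := by
  have hN' : (0 : ℝ) < N := by exact_mod_cast hN
  refine ⟨fun v => ⟨by positivity, ?_⟩, fun x y hxy => ?_⟩
  · rw [div_le_one hN']
    exact_mod_cast hw v
  · rw [← Finset.sum_div, le_div_iff₀ hN', one_mul, resolvers_eq_filter_withinDist G n hn]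
    exact_mod_cast h x y hxy

theorem IsResolvingFunction.one_le_sum_filter [Fintype V] [DecidableEq V] {G : SimpleGraph V}
    [DecidableRel G.Adj] {g : V → ℝ} (hg : IsResolvingFunction G g) (n : ℕ)
    (hn : ∀ u v, WithinDist G (n + 1) u v → WithinDist G n u v) {x y : V} (hxy : x ≠ y)
    {s : Finset V}
    (hs : (Finset.univ.filter fun z => ∃ k : Fin (n + 1),
      ¬(WithinDist G k x z ↔ WithinDist G k y z)) = s) : 1 ≤ ∑ z ∈ s, g z := by
  rw [← hs, ← resolvers_eq_filter_withinDist G n hn]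
  exact hg.2 x y hxy

end

/-! ### The three exceptional graphs -/

section

set_option maxRecDepth 10000

instance : DecidableRel H₁.Adj := inferInstanceAs (DecidableRel (SimpleGraph.fromEdgeSet _).Adj)
instance : DecidableRel H₂.Adj := inferInstanceAs (DecidableRel (SimpleGraph.fromEdgeSet _).Adj)
instance : DecidableRel H₃.Adj := inferInstanceAs (DecidableRel (SimpleGraph.fromEdgeSet _).Adj)


theorem H₁_resolving : IsResolvingFunction H₁ fun v => ((![0, 1, 1, 1] v : ℕ) : ℝ) / (2 : ℕ) :=
  isResolvingFunction_of_weights H₁ 2 (by decide) 2 (by decide) _ (by decide) (by decide)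

theorem dimf_H₁ : dimf H₁ = 3 / 2 := by
  refine le_antisymm ((dimf_le H₁_resolving).trans ?_) ?_
  · simp [Fin.sum_univ_succ]
    norm_num
  · obtain ⟨g, hg, he⟩ := (dimf_isLeast H₁).1
    rw [← he]
    -- The three constraints add up to twice the total weight.
    have h01 := hg.one_le_sum_filter 2 (by decide) (x := 0) (y := 1) (by decide)
      (s := {0, 1, 3}) (by decide)
    have h02 := hg.one_le_sum_filter 2 (by decide) (x := 0) (y := 2) (by decide)
      (s := {0, 2, 3}) (by decide)
    have h12 := hg.one_le_sum_filter 2 (by decide) (x := 1) (y := 2) (by decide)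
      (s := {1, 2}) (by decide)
    have hp := fun v => (hg.1 v).1
    simp only [Fin.forall_fin_succ, Fin.sum_univ_succ] at *
    simp at *
    linarith

theorem H₁_compl_resolving : IsResolvingFunction H₁ᶜ fun v => ((![0, 1, 1, 0] v : ℕ) : ℝ) / (2 : ℕ) :=
  isResolvingFunction_of_weights H₁ᶜ 2 (by decide) 2 (by decide) _ (by decide) (by decide)

theorem dimf_H₁_compl : dimf H₁ᶜ = 1 := by
  refine le_antisymm ((dimf_le H₁_compl_resolving).trans ?_) ?_
  · simp [Fin.sum_univ_succ]
    norm_num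
  · obtain ⟨g, hg, he⟩ := (dimf_isLeast H₁ᶜ).1
    rw [← he]
    have h12 := hg.one_le_sum_filter 2 (by decide) (x := 1) (y := 2) (by decide)
      (s := {1, 2}) (by decide)
    have hp := fun v => (hg.1 v).1
    simp only [Fin.forall_fin_succ, Fin.sum_univ_succ] at *
    simp at *
    linarith

theorem H₂_resolving : IsResolvingFunction H₂ fun v => ((![0, 1, 1, 1, 1] v : ℕ) : ℝ) / (2 : ℕ) :=
  isResolvingFunction_of_weights H₂ 3 (by decide) 2 (by decide) _ (by decide) (by decide)

theorem dimf_H₂ : dimf H₂ = 2 := by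
  refine le_antisymm ((dimf_le H₂_resolving).trans ?_) ?_
  · simp [Fin.sum_univ_succ]
    norm_num
  · obtain ⟨g, hg, he⟩ := (dimf_isLeast H₂).1
    rw [← he]
    -- These two sets partition the vertices.
    have h02 := hg.one_le_sum_filter 3 (by decide) (x := 0) (y := 2) (by decide)
      (s := {0, 2, 4}) (by decide)
    have h13 := hg.one_le_sum_filter 3 (by decide) (x := 1) (y := 3) (by decide)
      (s := {1, 3}) (by decide)
    have hp := fun v => (hg.1 v).1
    simp only [Fin.forall_fin_succ, Fin.sum_univ_succ] at *
    simp at *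
    linarith

theorem H₂_compl_resolving : IsResolvingFunction H₂ᶜ fun v => ((![1, 1, 0, 1, 0] v : ℕ) : ℝ) / (2 : ℕ) :=
  isResolvingFunction_of_weights H₂ᶜ 3 (by decide) 2 (by decide) _ (by decide) (by decide)

theorem dimf_H₂_compl : dimf H₂ᶜ = 3 / 2 := by
  refine le_antisymm ((dimf_le H₂_compl_resolving).trans ?_) ?_
  · simp [Fin.sum_univ_succ]
    norm_num
  · obtain ⟨g, hg, he⟩ := (dimf_isLeast H₂ᶜ).1
    rw [← he]
    -- Each vertex lies in exactly two of the three sets, so twice the total is at least 3.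
    have h13 := hg.one_le_sum_filter 3 (by decide) (x := 1) (y := 3) (by decide)
      (s := {1, 3}) (by decide)
    have h14 := hg.one_le_sum_filter 3 (by decide) (x := 1) (y := 4) (by decide)
      (s := {0, 1, 2, 4}) (by decide)
    have h34 := hg.one_le_sum_filter 3 (by decide) (x := 3) (y := 4) (by decide)
      (s := {0, 2, 3, 4}) (by decide)
    have hp := fun v => (hg.1 v).1
    simp only [Fin.forall_fin_succ, Fin.sum_univ_succ] at *
    simp at *
    linarith

theorem H₃_resolving : IsResolvingFunction H₃ fun v => ((![1, 0, 1, 1, 0, 1] v : ℕ) : ℝ) / (2 : ℕ) :=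
  isResolvingFunction_of_weights H₃ 3 (by decide) 2 (by decide) _ (by decide) (by decide)

theorem dimf_H₃ : dimf H₃ = 2 := by
  refine le_antisymm ((dimf_le H₃_resolving).trans ?_) ?_
  · simp [Fin.sum_univ_succ]
    norm_num
  · obtain ⟨g, hg, he⟩ := (dimf_isLeast H₃).1
    rw [← he]
    -- The sets of `h13` and `h24` partition the vertices and already give the bound 2.
    have h02 := hg.one_le_sum_filter 3 (by decide) (x := 0) (y := 2) (by decide)
      (s := {0, 2, 3}) (by decide)
    have h04 := hg.one_le_sum_filter 3 (by decide) (x := 0) (y := 4) (by decide)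
      (s := {0, 3, 4, 5}) (by decide)
    have h13 := hg.one_le_sum_filter 3 (by decide) (x := 1) (y := 3) (by decide)
      (s := {0, 1, 3}) (by decide)
    have h15 := hg.one_le_sum_filter 3 (by decide) (x := 1) (y := 5) (by decide)
      (s := {0, 1, 2, 5}) (by decide)
    have h24 := hg.one_le_sum_filter 3 (by decide) (x := 2) (y := 4) (by decide)
      (s := {2, 4, 5}) (by decide)
    have h35 := hg.one_le_sum_filter 3 (by decide) (x := 3) (y := 5) (by decide)
      (s := {2, 3, 5}) (by decide)
    have hp := fun v => (hg.1 v).1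
    simp only [Fin.forall_fin_succ, Fin.sum_univ_succ] at *
    simp at *
    linarith

theorem H₃_compl_resolving : IsResolvingFunction H₃ᶜ fun v => ((![2, 1, 2, 2, 1, 2] v : ℕ) : ℝ) / (6 : ℕ) :=
  isResolvingFunction_of_weights H₃ᶜ 3 (by decide) 6 (by decide) _ (by decide) (by decide)

theorem dimf_H₃_compl : dimf H₃ᶜ = 5 / 3 := by
  refine le_antisymm ((dimf_le H₃_compl_resolving).trans ?_) ?_
  · simp [Fin.sum_univ_succ]
    norm_num
  · obtain ⟨g, hg, he⟩ := (dimf_isLeast H₃ᶜ).1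
    rw [← he]
    -- Each vertex lies in exactly three of the five sets, so three times the total is at least 5.
    have h02 := hg.one_le_sum_filter 3 (by decide) (x := 0) (y := 2) (by decide)
      (s := {0, 2, 3}) (by decide)
    have h35 := hg.one_le_sum_filter 3 (by decide) (x := 3) (y := 5) (by decide)
      (s := {2, 3, 5}) (by decide)
    have h01 := hg.one_le_sum_filter 3 (by decide) (x := 0) (y := 1) (by decide)
      (s := {0, 1, 2, 4}) (by decide)
    have h45 := hg.one_le_sum_filter 3 (by decide) (x := 4) (y := 5) (by decide)
      (s := {1, 3, 4, 5}) (by decide)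
    have h05 := hg.one_le_sum_filter 3 (by decide) (x := 0) (y := 5) (by decide)
      (s := {0, 1, 4, 5}) (by decide)
    have hp := fun v => (hg.1 v).1
    simp only [Fin.forall_fin_succ, Fin.sum_univ_succ] at *
    simp at *
    linarith

theorem H₁_weights_resolving_compl : IsResolvingFunction H₁ᶜ fun v => ((![0, 1, 1, 1] v : ℕ) : ℝ) / (2 : ℕ) :=
  isResolvingFunction_of_weights H₁ᶜ 2 (by decide) 2 (by decide) _ (by decide) (by decide)

/-- The optimal weights of `H₁` also resolve its complement; the same happens for `H₂` and `H₃`. -/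
theorem Sdf_H₁ : Sdf {H₁, H₁ᶜ} = dimf H₁ := by
  refine le_antisymm ?_ (dimf_le_Sdf_of_mem (by simp))
  refine (Sdf_pair_le H₁_resolving H₁_weights_resolving_compl).trans ?_
  rw [dimf_H₁]
  simp [Fin.sum_univ_succ]
  norm_num

theorem H₂_weights_resolving_compl : IsResolvingFunction H₂ᶜ fun v => ((![0, 1, 1, 1, 1] v : ℕ) : ℝ) / (2 : ℕ) :=
  isResolvingFunction_of_weights H₂ᶜ 3 (by decide) 2 (by decide) _ (by decide) (by decide)

theorem Sdf_H₂ : Sdf {H₂, H₂ᶜ} = dimf H₂ := by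
  refine le_antisymm ?_ (dimf_le_Sdf_of_mem (by simp))
  refine (Sdf_pair_le H₂_resolving H₂_weights_resolving_compl).trans ?_
  rw [dimf_H₂]
  simp [Fin.sum_univ_succ]
  norm_num

theorem H₃_weights_resolving_compl : IsResolvingFunction H₃ᶜ fun v => ((![1, 0, 1, 1, 0, 1] v : ℕ) : ℝ) / (2 : ℕ) :=
  isResolvingFunction_of_weights H₃ᶜ 3 (by decide) 2 (by decide) _ (by decide) (by decide)

theorem Sdf_H₃ : Sdf {H₃, H₃ᶜ} = dimf H₃ := by
  refine le_antisymm ?_ (dimf_le_Sdf_of_mem (by simp))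
  refine (Sdf_pair_le H₃_resolving H₃_weights_resolving_compl).trans ?_
  rw [dimf_H₃]
  simp [Fin.sum_univ_succ]
  norm_num

end

/-! ### Triangles with pendants at two vertices -/

section

variable {V : Type*} {G : SimpleGraph V}

/-- The requirement of `Transfers` at a single pair. -/
def TransfersAt (G : SimpleGraph V) (σ : V → V) (u v : V) : Prop :=
  ∃ u' v', u' ≠ v' ∧ ∀ t, Gᶜ.edist u' t ≠ Gᶜ.edist v' t → AdjSep G u v (σ t)

theorem Dominates.cases {a b : V} (h : Dominates G a b) (s : V) :
    s = a ∨ s = b ∨ G.Adj a s ∨ G.Adj b s := by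
  by_cases h1 : s = a
  · exact Or.inl h1
  · by_cases h2 : s = b
    · exact Or.inr (Or.inl h2)
    · exact Or.inr (Or.inr (h s h1 h2))

theorem AdjSep.symm {u v t : V} (h : AdjSep G u v t) : AdjSep G v u t := by
  unfold AdjSep at *; tauto

theorem TransfersAt.symm {σ : V → V} {u v : V} (h : TransfersAt G σ u v) :
    TransfersAt G σ v u := by
  obtain ⟨u', v', hne, h⟩ := h
  exact ⟨u', v', hne, fun t ht => (h t ht).symm⟩

/-- A triangle `x, z, w` with pendant vertices at `x` (those in `P`) and at `z` (those in `Q`). -/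
structure IsTriangleXZ (G : SimpleGraph V) (x z w : V) (P Q : V → Prop) : Prop where
  ne : x ≠ z ∧ x ≠ w ∧ z ≠ w
  ne_P : ∀ v, P v → v ≠ x ∧ v ≠ z ∧ v ≠ w ∧ ¬Q v
  ne_Q : ∀ v, Q v → v ≠ x ∧ v ≠ z ∧ v ≠ w ∧ ¬P v
  cover : ∀ v, v = x ∨ v = z ∨ v = w ∨ P v ∨ Q v
  adj_x : ∀ t, G.Adj x t ↔ t = z ∨ t = w ∨ P t
  adj_z : ∀ t, G.Adj z t ↔ t = x ∨ t = w ∨ Q t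
  adj_w : ∀ t, G.Adj w t ↔ t = x ∨ t = z
  adj_P : ∀ v, P v → ∀ t, G.Adj v t ↔ t = x
  adj_Q : ∀ v, Q v → ∀ t, G.Adj v t ↔ t = z

/-- Dominating the pendants `l` and `m` needs one end in `{l, x}` and one in `{m, z}`; the only edge
between these sets is `xz`. -/
theorem IsTriangleXZ.dominates {x z w : V} {P Q : V → Prop} (h : IsTriangleXZ G x z w P Q)
    {l m : V} (hl : P l) (hm : Q m) {u t : V} (hut : G.Adj u t) (hd : Dominates G u t) :
    (u = x ∧ t = z) ∨ (u = z ∧ t = x) := by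
  have h1 := hd.cases l
  have h2 := hd.cases m
  have := h.ne
  have := h.ne_P l hl
  have := h.ne_Q m hm
  have := h.adj_P l hl
  have := h.adj_Q m hm
  have := G.adj_comm
  grind

theorem IsTriangleXZ.transfers {x z w : V} {P Q : V → Prop} (h : IsTriangleXZ G x z w P Q)
    {l m : V} (hl : P l) (hm : Q m) [Fintype V] : Transfers G := by
  classical
  have hirr : ∀ v, ¬G.Adj v v := fun v => G.irrefl
  have hR : ∀ u v t, Gᶜ.edist u t ≠ Gᶜ.edist v t → AdjSep G u v t ∨
      (G.Adj u t ∧ G.Adj v t ∧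
        ((u = x ∧ t = z) ∨ (u = z ∧ t = x) ∨ (v = x ∧ t = z) ∨ (v = z ∧ t = x))) := by
    intro u v t ht
    rcases adjSep_or_of_edist_compl_ne ht with h1 | ⟨h1, h2, h3 | h3⟩
    · exact Or.inl h1
    · have := h.dominates hl hm h1 h3; tauto
    · have := h.dominates hl hm h2 h3; tauto
  obtain ⟨hne, hPn, hQn, hc, hx, hz, hw, hP, hQ⟩ := h
  -- The surplus resolvers are `x` for pairs containing `z` and `z` for pairs containing `x`. The
  -- weight of `x` goes to the pendant at `z` if there is only one; with several pendants they are
  -- twins, and `x` can keep its weight. Symmetrically for `z`.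
  let σ : V → V := fun t => if t = x ∧ ∀ m', Q m' → m' = m then m else
    if t = z ∧ ∀ l', P l' → l' = l then l else t
  have hσ : ∀ t, t ≠ x → t ≠ z → σ t = t := by
    intro t h1 h2; simp [σ, h1, h2]
  have hσx : σ x = x ∨ σ x = m ∧ ∀ m', Q m' → m' = m := by grind
  have hσz : σ z = z ∨ σ z = l ∧ ∀ l', P l' → l' = l := by grind
  have hσx' : σ x = m ∨ ∃ m' m'', Q m' ∧ Q m'' ∧ m' ≠ m'' := by grind
  have hσz' : σ z = l ∨ ∃ l' l'', P l' ∧ P l'' ∧ l' ≠ l'' := by grind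
  clear_value σ
  -- Instead of `x`, `v` another pair is used, whose resolvers are sent into `w` and the pendants at
  -- `x`: two twin pendants, or the only pendant `l` and `w`, whose third resolver `z` is sent to
  -- `l`.
  have hxw' : ∀ v, (∀ t, t = w ∨ P t → AdjSep G x v t) → TransfersAt G σ x v := by
    intro v hv
    rcases hσz' with h1 | ⟨l', l'', h1, h2, h3⟩
    swap
    · refine ⟨l', l'', h3, fun t ht => hv _ ?_⟩
      have := hR l' l'' t ht
      clear hR ht hv
      simp only [AdjSep, hP l' h1, hP l'' h2] at this
      grind
    refine ⟨l, w, (hPn l hl).2.2.1, fun t ht => hv _ ?_⟩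
    have := hR l w t ht
    clear hR ht
    simp only [AdjSep, hP l hl, hw] at this
    grind
  have hzw' : ∀ v, (∀ t, t = w ∨ Q t → AdjSep G z v t) → TransfersAt G σ z v := by
    intro v hv
    rcases hσx' with h1 | ⟨m', m'', h1, h2, h3⟩
    swap
    · refine ⟨m', m'', h3, fun t ht => hv _ ?_⟩
      have := hR m' m'' t ht
      clear hR ht hv
      simp only [AdjSep, hQ m' h1, hQ m'' h2] at this
      grind
    refine ⟨m, w, (hQn m hm).2.2.1, fun t ht => hv _ ?_⟩
    have := hR m w t ht
    clear hR ht hxw'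
    simp only [AdjSep, hQ m hm, hw] at this
    grind
  have hPP : ∀ u v, P u → P v → u ≠ v → TransfersAt G σ u v := by
    intro u v hu hv huv
    refine ⟨u, v, huv, fun t ht => ?_⟩
    have := hR u v t ht
    clear hR ht hxw' hzw'
    simp only [AdjSep, hP u hu, hP v hv] at this ⊢
    grind
  have hQQ : ∀ u v, Q u → Q v → u ≠ v → TransfersAt G σ u v := by
    intro u v hu hv huv
    refine ⟨u, v, huv, fun t ht => ?_⟩
    have := hR u v t ht
    clear hR ht hxw' hzw'
    simp only [AdjSep, hQ u hu, hQ v hv] at this ⊢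
    grind
  have hPQ : ∀ u v, P u → Q v → TransfersAt G σ u v := by
    intro u v hu hv
    refine ⟨u, v, by grind, fun t ht => ?_⟩
    have := hR u v t ht
    clear hR ht hxw' hzw'
    simp only [AdjSep, hP u hu, hQ v hv] at this ⊢
    grind
  have hPw : ∀ u, P u → TransfersAt G σ u w := by
    intro u hu
    refine ⟨u, w, by grind, fun t ht => ?_⟩
    have := hR u w t ht
    clear hR ht hxw' hzw'
    simp only [AdjSep, hP u hu, hw] at this ⊢
    grind
  have hQw : ∀ u, Q u → TransfersAt G σ u w := by
    intro u hu
    refine ⟨u, w, by grind, fun t ht => ?_⟩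
    have := hR u w t ht
    clear hR ht hxw' hzw'
    simp only [AdjSep, hQ u hu, hw] at this ⊢
    grind
  have hxz : TransfersAt G σ x z := by
    refine ⟨x, z, hne.1, fun t ht => ?_⟩
    have := hR x z t ht
    clear hR ht hxw' hzw'
    simp only [AdjSep, hx, hz] at this ⊢
    grind
  have hxv : ∀ v, v ≠ x → TransfersAt G σ x v := by
    intro v hv
    by_cases hvz : v = z
    · exact hvz ▸ hxz
    · apply hxw'
      intro t ht
      simp only [AdjSep, hx]
      rcases hc v with rfl | rfl | rfl | h1 | h1
      · grind
      · grind
      · simp only [hw]; grind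
      · simp only [hP v h1]; grind
      · simp only [hQ v h1]; grind
  have hzv : ∀ v, v ≠ z → TransfersAt G σ z v := by
    intro v hv
    by_cases hvx : v = x
    · exact hvx ▸ hxz.symm
    · apply hzw'
      intro t ht
      simp only [AdjSep, hz]
      rcases hc v with rfl | rfl | rfl | h1 | h1
      · grind
      · grind
      · simp only [hw]; grind
      · simp only [hP v h1]; grind
      · simp only [hQ v h1]; grind
  refine ⟨σ, fun u v huv => ?_⟩
  change TransfersAt G σ u v
  rcases hc u with rfl | rfl | rfl | hu | hu
  · exact hxv v huv.symm
  · exact hzv v huv.symm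
  all_goals rcases hc v with rfl | rfl | rfl | hv | hv
  · exact (hxv _ huv).symm
  · exact (hzv _ huv).symm
  · exact absurd rfl huv
  · exact (hPw v hv).symm
  · exact (hQw v hv).symm
  · exact (hxv _ huv).symm
  · exact (hzv _ huv).symm
  · exact hPw u hu
  · exact hPP u v hu hv huv
  · exact hPQ u v hu hv
  · exact (hxv _ huv).symm
  · exact (hzv _ huv).symm
  · exact hQw u hu
  · exact (hPQ v u hv hu).symm
  · exact hQQ u v hu hv huv

end

/-! ### Triangles with pendants at one vertex or none -/

section

variable {V : Type*} {G : SimpleGraph V}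

theorem IsTriangleXZ.symm {x z w : V} {P Q : V → Prop} (h : IsTriangleXZ G x z w P Q) :
    IsTriangleXZ G z x w Q P := by
  obtain ⟨hne, hPn, hQn, hc, hx, hz, hw, hP, hQ⟩ := h
  refine ⟨⟨hne.1.symm, hne.2.2, hne.2.1⟩, ?_, ?_, ?_, hz, hx, ?_, hQ, hP⟩
  · intro v hv; have := hQn v hv; tauto
  · intro v hv; have := hPn v hv; tauto
  · intro v; have := hc v; tauto
  · intro v; rw [hw]; tauto

/-- Twins are resolved only by themselves, so only their two images have to separate `u` and `v`. -/
theorem transfersAt_of_twins {σ : V → V} {a b u v : V} (hab : a ≠ b)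
    (h : ∀ s, AdjSep G a b s → s = a ∨ s = b) (ha : AdjSep G u v (σ a)) (hb : AdjSep G u v (σ b)) :
    TransfersAt G σ u v := by
  refine ⟨a, b, hab, fun t ht => ?_⟩
  rcases eq_or_eq_of_twins h ht with rfl | rfl <;> assumption

/-- Both `z, w` and any two pendants are twins, and every pair of vertices is separated by both
members of some twin pair; no weight has to move. -/
theorem IsTriangleXZ.transfers_of_two {x z w : V} {P : V → Prop}
    (h : IsTriangleXZ G x z w P fun _ => False) {l l' : V} (hl : P l) (hl' : P l') (hll : l ≠ l')
    [Fintype V] : Transfers G := by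
  have hirr : ∀ v, ¬G.Adj v v := fun v => G.irrefl
  obtain ⟨hne, hPn, -, hc, hx, hz, hw, hP, -⟩ := h
  have hPP : ∀ a b, P a → P b → ∀ s, AdjSep G a b s → s = a ∨ s = b := by
    intro a b ha hb s hs
    simp only [AdjSep, hP a ha, hP b hb] at hs
    tauto
  have hzw : ∀ s, AdjSep G z w s → s = z ∨ s = w := by
    intro s hs
    simp only [AdjSep, hz, hw] at hs
    grind
  have hx' : ∀ v, v ≠ x → TransfersAt G id x v := by
    intro v hv
    rcases hc v with rfl | rfl | rfl | h1 | h1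
    · exact absurd rfl hv
    · apply transfersAt_of_twins hll (hPP l l' hl hl') <;>
        simp only [id, AdjSep, hx, hz] <;> grind
    · apply transfersAt_of_twins hll (hPP l l' hl hl') <;>
        simp only [id, AdjSep, hx, hw] <;> grind
    · apply transfersAt_of_twins hne.2.2 hzw <;>
        simp only [id, AdjSep, hx, hP v h1] <;> grind
    · exact h1.elim
  have hz' : TransfersAt G id z w := transfersAt_of_twins hne.2.2 hzw (Or.inl rfl) (Or.inr (Or.inl rfl))
  have hPz : ∀ v, P v → TransfersAt G id v z := by
    intro v hv
    apply transfersAt_of_twins hne.2.2 hzw <;> simp only [id, AdjSep, hP v hv, hz] <;> grind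
  have hPw : ∀ v, P v → TransfersAt G id v w := by
    intro v hv
    apply transfersAt_of_twins hne.2.2 hzw <;> simp only [id, AdjSep, hP v hv, hw] <;> grind
  have hPP' : ∀ a b, P a → P b → a ≠ b → TransfersAt G id a b := fun a b ha hb hab =>
    transfersAt_of_twins hab (hPP a b ha hb) (Or.inl rfl) (Or.inr (Or.inl rfl))
  refine ⟨id, fun u v huv => ?_⟩
  change TransfersAt G id u v
  rcases hc u with rfl | rfl | rfl | hu | hu
  · exact hx' v huv.symm
  all_goals rcases hc v with rfl | rfl | rfl | hv | hv
  all_goals first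
    | exact absurd rfl huv
    | exact (hx' _ huv).symm
    | exact hz'
    | exact hz'.symm
    | exact hPz _ hu
    | exact (hPz _ hv).symm
    | exact hPw _ hu
    | exact (hPw _ hv).symm
    | exact hPP' _ _ hu hv huv
    | exact hu.elim
    | exact hv.elim

theorem transfers_of_twins (h : ∀ u v : V, u ≠ v → ∀ s, AdjSep G u v s → s = u ∨ s = v)
    [Fintype V] : Transfers G :=
  ⟨id, fun u v huv =>
    transfersAt_of_twins huv (h u v huv) (Or.inl rfl) (Or.inr (Or.inl rfl))⟩

theorem IsTriangleXZ.transfers_of_none {x z w : V}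
    (h : IsTriangleXZ G x z w (fun _ => False) fun _ => False) [Fintype V] : Transfers G := by
  obtain ⟨hne, -, -, hc, hx, hz, hw, -, -⟩ := h
  refine transfers_of_twins fun u v huv s hs => ?_
  simp only [AdjSep] at hs
  have := hc s
  rcases hc u with rfl | rfl | rfl | ⟨⟨⟩⟩ | ⟨⟨⟩⟩ <;> rcases hc v with rfl | rfl | rfl | ⟨⟨⟩⟩ | ⟨⟨⟩⟩ <;>
    simp only [hx, hz, hw] at hs <;> grind

/-- An isomorphism from an enumeration of the vertices that matches the adjacencies. -/
theorem nonempty_iso_of_enum {n : ℕ} {H : SimpleGraph (Fin n)} (f : Fin n → V)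
    (hf : Function.Injective f) (hs : ∀ v, ∃ i, f i = v)
    (h : ∀ i j, G.Adj (f i) (f j) ↔ H.Adj i j) : Nonempty (G ≃g H) :=
  ⟨(⟨Equiv.ofBijective f ⟨hf, hs⟩, h _ _⟩ : H ≃g G).symm⟩

theorem IsTriangleXZ.nonempty_iso {x z w : V} {P : V → Prop}
    (h : IsTriangleXZ G x z w P fun _ => False) {l : V} (hl : P l) (hu : ∀ l', P l' → l' = l) :
    Nonempty (G ≃g H₁) := by
  obtain ⟨hne, hPn, -, hc, hx, hz, hw, hP, -⟩ := h
  obtain ⟨n1, n2, n3⟩ := hne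
  obtain ⟨n4, n5, n6, -⟩ := hPn l hl
  have p2 : ¬P z := fun h => (hPn z h).2.1 rfl
  have p3 : ¬P w := fun h => (hPn w h).2.2.1 rfl
  refine nonempty_iso_of_enum ![x, z, w, l] ?_ ?_ ?_
  · intro i j hij
    fin_cases i <;> fin_cases j <;> simp_all
  · intro v
    rcases hc v with rfl | rfl | rfl | h1 | h1
    · exact ⟨0, rfl⟩
    · exact ⟨1, rfl⟩
    · exact ⟨2, rfl⟩
    · exact ⟨3, (hu v h1).symm⟩
    · exact h1.elim
  · intro i j
    fin_cases i <;> fin_cases j <;>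
      simp [H₁, hx, hz, hw, hP l hl, hl, p2, p3, n1, n2, n3, n4, n5, n6, n1.symm, n2.symm,
        n3.symm]

end

/-! ### 4-cycles with pendants, and triangles with a tail -/

section

variable {V : Type*} {G : SimpleGraph V}

/-- A 4-cycle `x, z, q, p` with pendant vertices at `x` (those in `P`) and at `z`
(those in `Q`). -/
structure IsSquareXZ (G : SimpleGraph V) (x z q p : V) (P Q : V → Prop) : Prop where
  ne : x ≠ z ∧ x ≠ q ∧ x ≠ p ∧ z ≠ q ∧ z ≠ p ∧ q ≠ p
  ne_P : ∀ v, P v → v ≠ x ∧ v ≠ z ∧ v ≠ q ∧ v ≠ p ∧ ¬Q v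
  ne_Q : ∀ v, Q v → v ≠ x ∧ v ≠ z ∧ v ≠ q ∧ v ≠ p ∧ ¬P v
  cover : ∀ v, v = x ∨ v = z ∨ v = q ∨ v = p ∨ P v ∨ Q v
  adj_x : ∀ t, G.Adj x t ↔ t = z ∨ t = p ∨ P t
  adj_z : ∀ t, G.Adj z t ↔ t = x ∨ t = q ∨ Q t
  adj_q : ∀ t, G.Adj q t ↔ t = z ∨ t = p
  adj_p : ∀ t, G.Adj p t ↔ t = x ∨ t = q
  adj_P : ∀ v, P v → ∀ t, G.Adj v t ↔ t = x
  adj_Q : ∀ v, Q v → ∀ t, G.Adj v t ↔ t = z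

/-- A triangle `x, p, p'` and an edge from `x` to `z`, with pendant vertices at `x`
(those in `P`) and at `z` (those in `Q`). -/
structure IsTailedTriangle (G : SimpleGraph V) (x z p p' : V) (P Q : V → Prop) : Prop where
  ne : x ≠ z ∧ x ≠ p ∧ x ≠ p' ∧ z ≠ p ∧ z ≠ p' ∧ p ≠ p'
  ne_P : ∀ v, P v → v ≠ x ∧ v ≠ z ∧ v ≠ p ∧ v ≠ p' ∧ ¬Q v
  ne_Q : ∀ v, Q v → v ≠ x ∧ v ≠ z ∧ v ≠ p ∧ v ≠ p' ∧ ¬P v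
  cover : ∀ v, v = x ∨ v = z ∨ v = p ∨ v = p' ∨ P v ∨ Q v
  adj_x : ∀ t, G.Adj x t ↔ t = z ∨ t = p ∨ t = p' ∨ P t
  adj_z : ∀ t, G.Adj z t ↔ t = x ∨ Q t
  adj_p : ∀ t, G.Adj p t ↔ t = x ∨ t = p'
  adj_p' : ∀ t, G.Adj p' t ↔ t = x ∨ t = p
  adj_P : ∀ v, P v → ∀ t, G.Adj v t ↔ t = x
  adj_Q : ∀ v, Q v → ∀ t, G.Adj v t ↔ t = z

theorem IsSquareXZ.symm {x z q p : V} {P Q : V → Prop} (h : IsSquareXZ G x z q p P Q) :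
    IsSquareXZ G z x p q Q P := by
  obtain ⟨hne, hPn, hQn, hc, hx, hz, hq, hp, hP, hQ⟩ := h
  refine ⟨by grind, ?_, ?_, ?_, hz, hx, ?_, ?_, hQ, hP⟩
  · intro v hv; have := hQn v hv; tauto
  · intro v hv; have := hPn v hv; tauto
  · intro v; have := hc v; tauto
  · intro v; rw [hp]
  · intro v; rw [hq]

/-- An end of the edge must lie in `{l, x}`, and an edge at `l` has `x` as its other end. -/
theorem Dominates.of_pendant {l x u t : V} (hl : ∀ s, G.Adj l s ↔ s = x) (hut : G.Adj u t)
    (hd : Dominates G u t) : u = x ∨ t = x := by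
  rcases hd.cases l with rfl | rfl | h | h
  · exact Or.inr ((hl t).mp hut)
  · exact Or.inl ((hl u).mp hut.symm)
  · exact Or.inl ((hl u).mp h.symm)
  · exact Or.inr ((hl t).mp h.symm)

theorem IsSquareXZ.transfers_of_two {x z q p : V} {P Q : V → Prop} (h : IsSquareXZ G x z q p P Q)
    {l l' : V} (hl : P l) (hl' : P l') (hll : l ≠ l') [Fintype V] : Transfers G := by
  classical
  have hirr : ∀ v, ¬G.Adj v v := fun v => G.irrefl
  obtain ⟨hne, hPn, hQn, hc, hx, hz, hq, hp, hP, hQ⟩ := h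
  -- For pairs avoiding `x` the only possible surplus resolver is `x`, because a dominating edge
  -- contains `x`. If there are pendants at `z`, the edge contains `z` as well.
  have hR : ∀ u v t, u ≠ x → v ≠ x → Gᶜ.edist u t ≠ Gᶜ.edist v t → AdjSep G u v t ∨
      (G.Adj u t ∧ G.Adj v t ∧ t = x ∧ (u = z ∨ v = z ∨ ∀ m, ¬Q m)) := by
    intro u v t hu hv ht
    by_cases hQe : ∃ m, Q m
    · obtain ⟨m, hm⟩ := hQe
      rcases adjSep_or_of_edist_compl_ne ht with h1 | ⟨h1, h2, h3 | h3⟩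
      · exact Or.inl h1
      · have := h3.of_pendant (hP l hl) h1
        have := h3.of_pendant (hQ m hm) h1
        grind
      · have := h3.of_pendant (hP l hl) h2
        have := h3.of_pendant (hQ m hm) h2
        grind
    · push Not at hQe
      rcases adjSep_or_of_edist_compl_ne ht with h1 | ⟨h1, h2, h3 | h3⟩
      · exact Or.inl h1
      · have := h3.of_pendant (hP l hl) h1
        tauto
      · have := h3.of_pendant (hP l hl) h2
        tauto
  -- With pendants at `z`, the image `z` replaces `x` both as surplus resolver of pairs containing
  -- `z` and as true separator. Without them `z` and `p` are twins, and `q` separates the other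
  -- pairs that need `x`.
  let σ : V → V := fun t => if t = x then (if ∃ m, Q m then z else q) else t
  have hσ : ∀ t, t ≠ x → σ t = t := by
    intro t h1; simp [σ, h1]
  have hσx : ((∃ m, Q m) ∧ σ x = z) ∨ ((∀ m, ¬Q m) ∧ σ x = q) := by
    by_cases hm : ∃ m, Q m
    · exact Or.inl ⟨hm, by simp [σ, hm]⟩
    · exact Or.inr ⟨by simpa using hm, by simp [σ, hm]⟩
  clear_value σ
  have hPP : ∀ a b, P a → P b → ∀ s, AdjSep G a b s → s = a ∨ s = b := by
    intro a b ha hb s hs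
    simp only [AdjSep, hP a ha, hP b hb] at hs
    tauto
  -- Two pendants at `x` are twins that both separate `x` from any other vertex. This is where a
  -- second pendant is needed.
  have hxv : ∀ v, v ≠ x → TransfersAt G σ x v := by
    intro v hv
    have e1 := hσ l (hPn l hl).1
    have e2 := hσ l' (hPn l' hl').1
    apply transfersAt_of_twins hll (hPP l l' hl hl')
    all_goals
      simp only [e1, e2, AdjSep, hx]
      rcases hc v with rfl | rfl | rfl | rfl | h1 | h1
      · exact absurd rfl hv
      · simp only [hz]; grind
      · simp only [hq]; grind
      · simp only [hp]; grind
      · simp only [hP v h1]; grind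
      · simp only [hQ v h1]; grind
  have hzq' : TransfersAt G σ z q := by
    refine ⟨z, q, by grind, fun t ht => ?_⟩
    have h1 := hR z q t (by grind) (by grind) ht
    have h2 := hc t
    clear hR ht hxv
    simp only [AdjSep, hz, hq] at h1 ⊢
    grind
  have hzP' : ∀ v, P v → TransfersAt G σ z v := by
    intro v hv
    refine ⟨z, v, by grind, fun t ht => ?_⟩
    have h1 := hR z v t (by grind) (by grind) ht
    have h2 := hc t
    clear hR ht hxv
    simp only [AdjSep, hz, hP v hv] at h1 ⊢
    grind
  have hzQ' : ∀ v, Q v → TransfersAt G σ z v := by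
    intro v hv
    refine ⟨z, v, by grind, fun t ht => ?_⟩
    have h1 := hR z v t (by grind) (by grind) ht
    have h2 := hc t
    clear hR ht hxv
    simp only [AdjSep, hz, hQ v hv] at h1 ⊢
    grind
  have hqp' : TransfersAt G σ q p := by
    refine ⟨q, p, by grind, fun t ht => ?_⟩
    have h1 := hR q p t (by grind) (by grind) ht
    have h2 := hc t
    clear hR ht hxv
    simp only [AdjSep, hq, hp] at h1 ⊢
    grind
  have hqP' : ∀ v, P v → TransfersAt G σ q v := by
    intro v hv
    refine ⟨q, v, by grind, fun t ht => ?_⟩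
    have h1 := hR q v t (by grind) (by grind) ht
    have h2 := hc t
    clear hR ht hxv
    simp only [AdjSep, hq, hP v hv] at h1 ⊢
    grind
  have hqQ' : ∀ v, Q v → TransfersAt G σ q v := by
    intro v hv
    refine ⟨q, v, by grind, fun t ht => ?_⟩
    have h1 := hR q v t (by grind) (by grind) ht
    have h2 := hc t
    clear hR ht hxv
    simp only [AdjSep, hq, hQ v hv] at h1 ⊢
    grind
  have hpP' : ∀ v, P v → TransfersAt G σ p v := by
    intro v hv
    refine ⟨p, v, by grind, fun t ht => ?_⟩
    have h1 := hR p v t (by grind) (by grind) ht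
    have h2 := hc t
    clear hR ht hxv
    simp only [AdjSep, hp, hP v hv] at h1 ⊢
    grind
  have hpQ' : ∀ v, Q v → TransfersAt G σ p v := by
    intro v hv
    refine ⟨p, v, by grind, fun t ht => ?_⟩
    have h1 := hR p v t (by grind) (by grind) ht
    have h2 := hc t
    clear hR ht hxv
    simp only [AdjSep, hp, hQ v hv] at h1 ⊢
    grind
  have hPQ' : ∀ u v, P u → Q v → u ≠ v → TransfersAt G σ u v := by
    intro u v hu hv huv
    refine ⟨u, v, by grind, fun t ht => ?_⟩
    have h1 := hR u v t (by grind) (by grind) ht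
    have h2 := hc t
    clear hR ht hxv
    simp only [AdjSep, hP u hu, hQ v hv] at h1 ⊢
    grind
  have hQQ' : ∀ u v, Q u → Q v → u ≠ v → TransfersAt G σ u v := by
    intro u v hu hv huv
    refine ⟨u, v, huv, fun t ht => ?_⟩
    have h1 := hR u v t (by grind) (by grind) ht
    have h2 := hc t
    clear hR ht hxv
    simp only [AdjSep, hQ u hu, hQ v hv] at h1 ⊢
    grind
  have hzp' : TransfersAt G σ z p := by
    by_cases hQe : ∃ m, Q m
    · refine ⟨z, p, by grind, fun t ht => ?_⟩
      have h1 := hR z p t (by grind) (by grind) ht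
      have h2 := hc t
      clear hR ht hxv
      simp only [AdjSep, hz, hp] at h1 ⊢
      grind
    · apply transfersAt_of_twins (a := z) (b := p) (by grind)
      · intro s hs
        simp only [AdjSep, hz, hp] at hs
        grind
      · exact Or.inl (hσ z (by grind))
      · exact Or.inr (Or.inl (hσ p (by grind)))
  have hPP' : ∀ u v, P u → P v → u ≠ v → TransfersAt G σ u v := fun u v hu hv huv =>
    transfersAt_of_twins huv (hPP u v hu hv) (Or.inl (hσ u (hPn u hu).1))
      (Or.inr (Or.inl (hσ v (hPn v hv).1)))
  refine ⟨σ, fun u v huv => ?_⟩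
  change TransfersAt G σ u v
  rcases hc u with rfl | rfl | rfl | rfl | hu | hu
  · exact hxv v huv.symm
  all_goals rcases hc v with rfl | rfl | rfl | rfl | hv | hv
  all_goals first
    | exact absurd rfl huv
    | exact (hxv _ huv).symm
    | exact hzq'
    | exact hzq'.symm
    | exact hzP' _ hv
    | exact (hzP' _ hu).symm
    | exact hzQ' _ hv
    | exact (hzQ' _ hu).symm
    | exact hqp'
    | exact hqp'.symm
    | exact hqP' _ hv
    | exact (hqP' _ hu).symm
    | exact hqQ' _ hv
    | exact (hqQ' _ hu).symm
    | exact hpP' _ hv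
    | exact (hpP' _ hu).symm
    | exact hpQ' _ hv
    | exact (hpQ' _ hu).symm
    | exact hPQ' _ _ hu hv huv
    | exact (hPQ' _ _ hv hu huv.symm).symm
    | exact hQQ' _ _ hu hv huv
    | exact hzp'
    | exact hzp'.symm
    | exact hPP' _ _ hu hv huv

/-- In a 4-cycle opposite vertices are twins, and adjacent vertices are separated by every vertex.
-/
theorem IsSquareXZ.transfers_of_none {x z q p : V}
    (h : IsSquareXZ G x z q p (fun _ => False) fun _ => False) [Fintype V] : Transfers G := by
  obtain ⟨hne, -, -, hc, hx, hz, hq, hp, -, -⟩ := h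
  have hirr : ∀ v, ¬G.Adj v v := fun v => G.irrefl
  have t1 : ∀ s, AdjSep G x q s → s = x ∨ s = q := by
    intro s hs
    simp only [AdjSep, hx, hq] at hs
    grind
  have t2 : ∀ s, AdjSep G z p s → s = z ∨ s = p := by
    intro s hs
    simp only [AdjSep, hz, hp] at hs
    grind
  have h1 : TransfersAt G id x q := transfersAt_of_twins (by grind) t1 (Or.inl rfl) (Or.inr (Or.inl rfl))
  have h2 : TransfersAt G id z p := transfersAt_of_twins (by grind) t2 (Or.inl rfl) (Or.inr (Or.inl rfl))
  have h3 : TransfersAt G id x z := by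
    apply transfersAt_of_twins (by grind) t1 <;> simp only [id, AdjSep, hx, hz] <;> grind
  have h4 : TransfersAt G id x p := by
    apply transfersAt_of_twins (by grind) t1 <;> simp only [id, AdjSep, hx, hp] <;> grind
  have h5 : TransfersAt G id q z := by
    apply transfersAt_of_twins (by grind) t1 <;> simp only [id, AdjSep, hq, hz] <;> grind
  have h6 : TransfersAt G id q p := by
    apply transfersAt_of_twins (by grind) t1 <;> simp only [id, AdjSep, hq, hp] <;> grind
  refine ⟨id, fun u v huv => ?_⟩
  change TransfersAt G id u v
  rcases hc u with rfl | rfl | rfl | rfl | ⟨⟨⟩⟩ | ⟨⟨⟩⟩ <;>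
    rcases hc v with rfl | rfl | rfl | rfl | ⟨⟨⟩⟩ | ⟨⟨⟩⟩
  all_goals first
    | exact absurd rfl huv
    | exact h1
    | exact h1.symm
    | exact h2
    | exact h2.symm
    | exact h3
    | exact h3.symm
    | exact h4
    | exact h4.symm
    | exact h5
    | exact h5.symm
    | exact h6
    | exact h6.symm

theorem IsTailedTriangle.transfers {x z p p' : V} {P Q : V → Prop}
    (h : IsTailedTriangle G x z p p' P Q) {m : V} (hm : Q m) [Fintype V] : Transfers G := by
  classical
  have hirr : ∀ v, ¬G.Adj v v := fun v => G.irrefl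
  obtain ⟨hne, hPn, hQn, hc, hx, hz, hp, hp', hP, hQ⟩ := h
  have hdom : ∀ u t, G.Adj u t → Dominates G u t → (u = x ∧ t = z) ∨ (u = z ∧ t = x) := by
    intro u t hut hd
    have h1 := hd.of_pendant (hQ m hm) hut
    have h2 := hd.cases p
    have h3 : ∀ s, G.Adj s p ↔ s = x ∨ s = p' := fun s => by rw [G.adj_comm, hp]
    have h4 : ∀ s, G.Adj s z ↔ s = x ∨ Q s := fun s => by rw [G.adj_comm, hz]
    rw [h3, h3] at h2
    rcases h1 with rfl | rfl
    · rw [hz] at hut; grind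
    · rw [h4] at hut; grind
  have hR : ∀ u v t, Gᶜ.edist u t ≠ Gᶜ.edist v t → AdjSep G u v t ∨
      (G.Adj u t ∧ G.Adj v t ∧
        ((u = x ∧ t = z) ∨ (u = z ∧ t = x) ∨ (v = x ∧ t = z) ∨ (v = z ∧ t = x))) := by
    intro u v t ht
    rcases adjSep_or_of_edist_compl_ne ht with h1 | ⟨h1, h2, h3 | h3⟩
    · exact Or.inl h1
    · have := hdom u t h1 h3; tauto
    · have := hdom v t h2 h3; tauto
  -- Only `xz` dominates, and the only surplus resolver is `x`, for pairs of `z` and a pendant at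
  -- `x`; there `z` is a separator. Where `x` is a true separator in a pair used below, `z` is one
  -- too.
  let σ : V → V := fun t => if t = x then z else t
  have hσ : ∀ t, t ≠ x → σ t = t := by
    intro t h1; simp [σ, h1]
  have hσx : σ x = z := by simp [σ]
  clear_value σ
  have hpp : ∀ s, AdjSep G p p' s → s = p ∨ s = p' := by
    intro s hs
    simp only [AdjSep, hp, hp'] at hs
    grind
  -- `p` and `p'` are twins, which settles every pair separated by both.
  have hxv : ∀ u v, AdjSep G u v p → AdjSep G u v p' → TransfersAt G σ u v := by
    intro u v h1 h2
    apply transfersAt_of_twins (σ := σ) hne.2.2.2.2.2 hpp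
    · rwa [hσ p (by grind)]
    · rwa [hσ p' (by grind)]
  have hxp' : TransfersAt G σ x p := by
    refine ⟨x, p, by grind, fun t ht => ?_⟩
    have h1 := hR x p t ht
    have h2 := hc t
    clear hR ht hxv
    simp only [AdjSep, hx, hp] at h1 ⊢
    grind
  have hxp'' : TransfersAt G σ x p' := by
    refine ⟨x, p', by grind, fun t ht => ?_⟩
    have h1 := hR x p' t ht
    have h2 := hc t
    clear hR ht hxv
    simp only [AdjSep, hx, hp'] at h1 ⊢
    grind
  have hzP' : ∀ v, P v → TransfersAt G σ z v := by
    intro v hv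
    refine ⟨z, v, by grind, fun t ht => ?_⟩
    have h1 := hR z v t ht
    have h2 := hc t
    clear hR ht hxv
    simp only [AdjSep, hz, hP v hv] at h1 ⊢
    grind
  have hzQ' : ∀ v, Q v → TransfersAt G σ z v := by
    intro v hv
    refine ⟨z, v, by grind, fun t ht => ?_⟩
    have h1 := hR z v t ht
    have h2 := hc t
    clear hR ht hxv
    simp only [AdjSep, hz, hQ v hv] at h1 ⊢
    grind
  have hpp'' : TransfersAt G σ p p' := by
    refine ⟨p, p', by grind, fun t ht => ?_⟩
    have h1 := hR p p' t ht
    have h2 := hc t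
    clear hR ht hxv
    simp only [AdjSep, hp, hp'] at h1 ⊢
    grind
  have hPP' : ∀ u v, P u → P v → u ≠ v → TransfersAt G σ u v := by
    intro u v hu hv huv
    refine ⟨u, v, huv, fun t ht => ?_⟩
    have h1 := hR u v t ht
    have h2 := hc t
    clear hR ht hxv
    simp only [AdjSep, hP u hu, hP v hv] at h1 ⊢
    grind
  have hPQ' : ∀ u v, P u → Q v → u ≠ v → TransfersAt G σ u v := by
    intro u v hu hv huv
    refine ⟨u, v, by grind, fun t ht => ?_⟩
    have h1 := hR u v t ht
    have h2 := hc t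
    clear hR ht hxv
    simp only [AdjSep, hP u hu, hQ v hv] at h1 ⊢
    grind
  have hQQ' : ∀ u v, Q u → Q v → u ≠ v → TransfersAt G σ u v := by
    intro u v hu hv huv
    refine ⟨u, v, huv, fun t ht => ?_⟩
    have h1 := hR u v t ht
    have h2 := hc t
    clear hR ht hxv
    simp only [AdjSep, hQ u hu, hQ v hv] at h1 ⊢
    grind
  have hxz' : TransfersAt G σ x z := by
    apply hxv <;> simp only [AdjSep, hx, hz] <;> grind
  have hxP' : ∀ v, P v → TransfersAt G σ x v := by
    intro v hv
    have := hPn v hv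
    apply hxv <;> simp only [AdjSep, hx, hP v hv] <;> grind
  have hxQ' : ∀ v, Q v → TransfersAt G σ x v := by
    intro v hv
    have := hQn v hv
    apply hxv <;> simp only [AdjSep, hx, hQ v hv] <;> grind
  have hzp' : TransfersAt G σ z p := by
    apply hxv <;> simp only [AdjSep, hz, hp] <;> grind
  have hzp'' : TransfersAt G σ z p' := by
    apply hxv <;> simp only [AdjSep, hz, hp'] <;> grind
  have hpP' : ∀ v, P v → TransfersAt G σ p v := by
    intro v hv
    have := hPn v hv
    apply hxv <;> simp only [AdjSep, hp, hP v hv] <;> grind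
  have hpQ' : ∀ v, Q v → TransfersAt G σ p v := by
    intro v hv
    have := hQn v hv
    apply hxv <;> simp only [AdjSep, hp, hQ v hv] <;> grind
  have hp'P' : ∀ v, P v → TransfersAt G σ p' v := by
    intro v hv
    have := hPn v hv
    apply hxv <;> simp only [AdjSep, hp', hP v hv] <;> grind
  have hp'Q' : ∀ v, Q v → TransfersAt G σ p' v := by
    intro v hv
    have := hQn v hv
    apply hxv <;> simp only [AdjSep, hp', hQ v hv] <;> grind
  refine ⟨σ, fun u v huv => ?_⟩
  change TransfersAt G σ u v
  rcases hc u with rfl | rfl | rfl | rfl | hu | hu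
  all_goals rcases hc v with rfl | rfl | rfl | rfl | hv | hv
  all_goals first
    | exact absurd rfl huv
    | exact hxp'
    | exact hxp'.symm
    | exact hxp''
    | exact hxp''.symm
    | exact hzP' _ hv
    | exact (hzP' _ hu).symm
    | exact hzQ' _ hv
    | exact (hzQ' _ hu).symm
    | exact hpp''
    | exact hpp''.symm
    | exact hPP' _ _ hu hv huv
    | exact hPQ' _ _ hu hv huv
    | exact (hPQ' _ _ hv hu huv.symm).symm
    | exact hQQ' _ _ hu hv huv
    | exact hxz'
    | exact hxz'.symm
    | exact hxP' _ hv
    | exact (hxP' _ hu).symm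
    | exact hxQ' _ hv
    | exact (hxQ' _ hu).symm
    | exact hzp'
    | exact hzp'.symm
    | exact hzp''
    | exact hzp''.symm
    | exact hpP' _ hv
    | exact (hpP' _ hu).symm
    | exact hpQ' _ hv
    | exact (hpQ' _ hu).symm
    | exact hp'P' _ hv
    | exact (hp'P' _ hu).symm
    | exact hp'Q' _ hv
    | exact (hp'Q' _ hu).symm

theorem IsSquareXZ.nonempty_iso_of_one {x z q p : V} {P : V → Prop}
    (h : IsSquareXZ G x z q p P fun _ => False) {l : V} (hl : P l) (hu : ∀ l', P l' → l' = l) :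
    Nonempty (G ≃g H₂) := by
  obtain ⟨hne, hPn, -, hc, hx, hz, hq, hp, hP, -⟩ := h
  obtain ⟨n1, n2, n3, n4, n5, n6⟩ := hne
  obtain ⟨m1, m2, m3, m4, -⟩ := hPn l hl
  have p2 : ¬P z := fun h => (hPn z h).2.1 rfl
  have p3 : ¬P q := fun h => (hPn q h).2.2.1 rfl
  have p4 : ¬P p := fun h => (hPn p h).2.2.2.1 rfl
  refine nonempty_iso_of_enum ![x, z, q, p, l] ?_ ?_ ?_
  · intro i j hij
    fin_cases i <;> fin_cases j <;> first | rfl | (exfalso; simp at hij; grind)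
  · intro v
    rcases hc v with rfl | rfl | rfl | rfl | h1 | h1
    · exact ⟨0, rfl⟩
    · exact ⟨1, rfl⟩
    · exact ⟨2, rfl⟩
    · exact ⟨3, rfl⟩
    · exact ⟨4, (hu v h1).symm⟩
    · exact h1.elim
  · intro i j
    fin_cases i <;> fin_cases j <;>
      simp [H₂, hx, hz, hq, hp, hP l hl, hl, p2, p3, p4, n1, n2, n3, n4, n5, n6, m1, m2, m3, m4,
        n1.symm, n2.symm, n3.symm, n4.symm, n5.symm, n6.symm]

theorem IsSquareXZ.nonempty_iso_of_one_one {x z q p : V} {P Q : V → Prop}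
    (h : IsSquareXZ G x z q p P Q) {l m : V} (hl : P l) (hu : ∀ l', P l' → l' = l)
    (hm : Q m) (hu' : ∀ m', Q m' → m' = m) : Nonempty (G ≃g H₃) := by
  obtain ⟨hne, hPn, hQn, hc, hx, hz, hq, hp, hP, hQ⟩ := h
  obtain ⟨n1, n2, n3, n4, n5, n6⟩ := hne
  obtain ⟨m1, m2, m3, m4, m5⟩ := hPn l hl
  obtain ⟨k1, k2, k3, k4, k5⟩ := hQn m hm
  have hP' : ∀ v, P v ↔ v = l := fun v => ⟨hu v, fun h => h ▸ hl⟩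
  have hQ' : ∀ v, Q v ↔ v = m := fun v => ⟨hu' v, fun h => h ▸ hm⟩
  rw [hQ'] at m5
  -- The path runs from one pendant around the 4-cycle to the other, and `xz` is the added edge.
  refine nonempty_iso_of_enum ![l, x, p, q, z, m] ?_ ?_ ?_
  · intro i j hij
    fin_cases i <;> fin_cases j <;> first | rfl | (exfalso; simp at hij; grind)
  · intro v
    rcases hc v with rfl | rfl | rfl | rfl | h1 | h1
    · exact ⟨1, rfl⟩
    · exact ⟨4, rfl⟩
    · exact ⟨3, rfl⟩
    · exact ⟨2, rfl⟩
    · exact ⟨0, (hu v h1).symm⟩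
    · exact ⟨5, (hu' v h1).symm⟩
  · intro i j
    fin_cases i <;> fin_cases j <;>
      simp [H₃, hx, hz, hq, hp, hP l hl, hQ m hm, hP', hQ', n1, n2, n3, n4, n5, n6, m1, m2, m3, m4,
        m5, k1, k2, k3, k4, n1.symm, n2.symm, n3.symm, n4.symm, n5.symm, n6.symm, m2.symm,
        m3.symm, m4.symm, Ne.symm m5, k1.symm, k3.symm, k4.symm]

end

/-! ### Classification by a dominating edge -/

section

variable {V : Type*} {G : SimpleGraph V}

theorem transfers_of_not_dominates (h : ∀ u t, G.Adj u t → ¬Dominates G u t) [Fintype V] :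
    Transfers G := by
  refine ⟨id, fun u v huv => ⟨u, v, huv, fun t ht => ?_⟩⟩
  rcases adjSep_or_of_edist_compl_ne ht with h1 | ⟨h1, h2, h3 | h3⟩
  · exact h1
  · exact absurd h3 (h _ _ h1)
  · exact absurd h3 (h _ _ h2)

/-- Domination puts each remaining vertex next to `x` or `z`. Any further edge would close a
triangle or a 4-cycle through a vertex outside `{x, z, w}`, which the unique cycle forbids. The two
results below argue in the same way. -/
theorem isTriangleXZ_of_dominates {S : V → Prop}
    (tri : ∀ a b c, G.Adj a b → G.Adj b c → G.Adj c a → ∀ v, S v ↔ v = a ∨ v = b ∨ v = c)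
    (quad : ∀ a b c d, G.Adj a b → G.Adj b c → G.Adj c d → G.Adj d a → a ≠ c → b ≠ d →
      ∀ v, S v ↔ v = a ∨ v = b ∨ v = c ∨ v = d)
    {x z w : V} (hxz : G.Adj x z) (hxw : G.Adj x w) (hzw : G.Adj z w) (hd : Dominates G x z) :
    ∃ P Q, IsTriangleXZ G x z w P Q := by
  have hS := tri x z w hxz hzw hxw.symm
  have irr : ∀ v, ¬G.Adj v v := fun v => G.irrefl
  have T : ∀ a b c, G.Adj a b → G.Adj b c → G.Adj c a → a = x ∨ a = z ∨ a = w :=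
    fun a b c h1 h2 h3 => (hS a).mp ((tri a b c h1 h2 h3 a).mpr (Or.inl rfl))
  have F : ∀ a b c d, G.Adj a b → G.Adj b c → G.Adj c d → G.Adj d a → a ≠ c → b ≠ d →
      a = x ∨ a = z ∨ a = w :=
    fun a b c d h1 h2 h3 h4 h5 h6 => (hS a).mp ((quad a b c d h1 h2 h3 h4 h5 h6 a).mpr (Or.inl rfl))
  let P : V → Prop := fun v => v ≠ z ∧ v ≠ w ∧ G.Adj x v
  let Q : V → Prop := fun v => v ≠ x ∧ v ≠ w ∧ G.Adj z v
  have n1 := hxz.ne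
  have n2 := hxw.ne
  have n3 := hzw.ne
  have symm := @G.adj_comm
  have dP : ∀ v, P v ↔ v ≠ z ∧ v ≠ w ∧ G.Adj x v := fun v => Iff.rfl
  have dQ : ∀ v, Q v ↔ v ≠ x ∧ v ≠ w ∧ G.Adj z v := fun v => Iff.rfl
  clear_value P Q
  clear hS tri quad
  have Px : ∀ v, P v → v ≠ x := by grind
  have Qz : ∀ v, Q v → v ≠ z := by grind
  have a1 : ∀ v, P v → ¬G.Adj v z := fun v h1 h2 => by
    have := T v z x h2 hxz.symm ((dP v).mp h1).2.2; grind
  have a2 : ∀ v, P v → ¬G.Adj v w := fun v h1 h2 => by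
    have := T v w x h2 hxw.symm ((dP v).mp h1).2.2; grind
  have a3 : ∀ v v', P v → P v' → ¬G.Adj v v' := fun v v' h1 h2 h3 => by
    have := T v v' x h3 ((dP v').mp h2).2.2.symm ((dP v).mp h1).2.2; grind
  have b1 : ∀ v, Q v → ¬G.Adj v x := fun v h1 h2 => by
    have := T v x z h2 hxz ((dQ v).mp h1).2.2; grind
  have b2 : ∀ v, Q v → ¬G.Adj v w := fun v h1 h2 => by
    have := T v w z h2 hzw.symm ((dQ v).mp h1).2.2; grind
  have b3 : ∀ v v', Q v → Q v' → ¬G.Adj v v' := fun v v' h1 h2 h3 => by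
    have := T v v' z h3 ((dQ v').mp h2).2.2.symm ((dQ v).mp h1).2.2; grind
  have c1 : ∀ v m, P v → Q m → ¬G.Adj v m := fun v m h1 h2 h3 => by
    have := F v m z x h3 ((dQ m).mp h2).2.2.symm hxz.symm ((dP v).mp h1).2.2
      ((dP v).mp h1).1 ((dQ m).mp h2).1
    grind
  have cov : ∀ v, v = x ∨ v = z ∨ v = w ∨ P v ∨ Q v := fun v => by
    have := hd.cases v; grind
  clear hd T F
  refine ⟨P, Q, ⟨⟨n1, n2, n3⟩, by grind, by grind, cov, ?_, ?_, ?_, ?_, ?_⟩⟩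
  · intro t; have := cov t; grind
  · intro t; have := cov t; grind
  · intro t; have := cov t; grind
  · intro v hv t; have := cov t; grind
  · intro v hv t; have := cov t; grind

theorem isTailedTriangle_of_dominates {S : V → Prop}
    (tri : ∀ a b c, G.Adj a b → G.Adj b c → G.Adj c a → ∀ v, S v ↔ v = a ∨ v = b ∨ v = c)
    (quad : ∀ a b c d, G.Adj a b → G.Adj b c → G.Adj c d → G.Adj d a → a ≠ c → b ≠ d →
      ∀ v, S v ↔ v = a ∨ v = b ∨ v = c ∨ v = d)
    {x z p p' : V} (hxz : G.Adj x z) (hxp : G.Adj x p) (hxp' : G.Adj x p') (hpp : G.Adj p p')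
    (n4 : z ≠ p) (n5 : z ≠ p') (hd : Dominates G x z) :
    ∃ P, IsTailedTriangle G x z p p' P (fun v => v ≠ x ∧ G.Adj z v) := by
  have hS := tri x p p' hxp hpp hxp'.symm
  have irr : ∀ v, ¬G.Adj v v := fun v => G.irrefl
  have T : ∀ a b c, G.Adj a b → G.Adj b c → G.Adj c a → a = x ∨ a = p ∨ a = p' :=
    fun a b c h1 h2 h3 => (hS a).mp ((tri a b c h1 h2 h3 a).mpr (Or.inl rfl))
  have F : ∀ a b c d, G.Adj a b → G.Adj b c → G.Adj c d → G.Adj d a → a ≠ c → b ≠ d →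
      a = x ∨ a = p ∨ a = p' :=
    fun a b c d h1 h2 h3 h4 h5 h6 => (hS a).mp ((quad a b c d h1 h2 h3 h4 h5 h6 a).mpr (Or.inl rfl))
  let P : V → Prop := fun v => v ≠ z ∧ v ≠ p ∧ v ≠ p' ∧ G.Adj x v
  let Q : V → Prop := fun v => v ≠ x ∧ G.Adj z v
  have n1 := hxz.ne
  have n2 := hxp.ne
  have n3 := hxp'.ne
  have n6 := hpp.ne
  have symm := @G.adj_comm
  have dP : ∀ v, P v ↔ v ≠ z ∧ v ≠ p ∧ v ≠ p' ∧ G.Adj x v := fun v => Iff.rfl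
  have dQ : ∀ v, Q v ↔ v ≠ x ∧ G.Adj z v := fun v => Iff.rfl
  change ∃ P, IsTailedTriangle G x z p p' P Q
  clear_value P Q
  clear hS tri quad
  have z1 : ¬G.Adj z p := fun h => by have := T z p x h hxp.symm hxz; grind
  have z2 : ¬G.Adj z p' := fun h => by have := T z p' x h hxp'.symm hxz; grind
  have Px : ∀ v, P v → v ≠ x := by grind
  have Qz : ∀ v, Q v → v ≠ z ∧ v ≠ p ∧ v ≠ p' := by grind
  have a1 : ∀ v, P v → ¬G.Adj v z := fun v h1 h2 => by
    have := T v z x h2 hxz.symm ((dP v).mp h1).2.2.2; grind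
  have a2 : ∀ v, P v → ¬G.Adj v p := fun v h1 h2 => by
    have := T v p x h2 hxp.symm ((dP v).mp h1).2.2.2; grind
  have a2' : ∀ v, P v → ¬G.Adj v p' := fun v h1 h2 => by
    have := T v p' x h2 hxp'.symm ((dP v).mp h1).2.2.2; grind
  have a3 : ∀ v v', P v → P v' → ¬G.Adj v v' := fun v v' h1 h2 h3 => by
    have := T v v' x h3 ((dP v').mp h2).2.2.2.symm ((dP v).mp h1).2.2.2; grind
  have b1 : ∀ v, Q v → ¬G.Adj v x := fun v h1 h2 => by
    have := T v x z h2 hxz ((dQ v).mp h1).2; grind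
  have b2 : ∀ v, Q v → ¬G.Adj v p := fun v h1 h2 => by
    have := F v p x z h2 hxp.symm hxz ((dQ v).mp h1).2 ((dQ v).mp h1).1 n4.symm; grind
  have b2' : ∀ v, Q v → ¬G.Adj v p' := fun v h1 h2 => by
    have := F v p' x z h2 hxp'.symm hxz ((dQ v).mp h1).2 ((dQ v).mp h1).1 n5.symm; grind
  have b3 : ∀ v v', Q v → Q v' → ¬G.Adj v v' := fun v v' h1 h2 h3 => by
    have := T v v' z h3 ((dQ v').mp h2).2.symm ((dQ v).mp h1).2; grind
  have c1 : ∀ v m, P v → Q m → ¬G.Adj v m := fun v m h1 h2 h3 => by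
    have := F v m z x h3 ((dQ m).mp h2).2.symm hxz.symm ((dP v).mp h1).2.2.2
      ((dP v).mp h1).1 ((dQ m).mp h2).1
    grind
  have cov : ∀ v, v = x ∨ v = z ∨ v = p ∨ v = p' ∨ P v ∨ Q v := fun v => by
    have := hd.cases v; grind
  clear hd T F
  refine ⟨P, ⟨⟨n1, n2, n3, n4, n5, n6⟩, by grind, by grind, cov, ?_, ?_, ?_, ?_, ?_, ?_⟩⟩
  · intro t; have := cov t; grind
  · intro t; have := cov t; grind
  · intro t; have := cov t; grind
  · intro t; have := cov t; grind
  · intro v hv t; have := cov t; grind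
  · intro v hv t; have := cov t; grind

theorem isSquareXZ_of_dominates {S : V → Prop}
    (tri : ∀ a b c, G.Adj a b → G.Adj b c → G.Adj c a → ∀ v, S v ↔ v = a ∨ v = b ∨ v = c)
    (quad : ∀ a b c d, G.Adj a b → G.Adj b c → G.Adj c d → G.Adj d a → a ≠ c → b ≠ d →
      ∀ v, S v ↔ v = a ∨ v = b ∨ v = c ∨ v = d)
    {x z q p : V} (hxz : G.Adj x z) (hzq : G.Adj z q) (hqp : G.Adj q p) (hpx : G.Adj p x)
    (n2 : x ≠ q) (n5 : z ≠ p) (hd : Dominates G x z) :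
    ∃ P Q, IsSquareXZ G x z q p P Q := by
  have hS := quad x z q p hxz hzq hqp hpx n2 n5
  have irr : ∀ v, ¬G.Adj v v := fun v => G.irrefl
  have n1 := hxz.ne
  have n3 := hpx.ne'
  have n4 := hzq.ne
  have n6 := hqp.ne
  have symm := @G.adj_comm
  -- The three vertices of a triangle cannot exhaust the four distinct vertices of the unique cycle.
  have T : ∀ a b c, G.Adj a b → G.Adj b c → G.Adj c a → False := by
    intro a b c h1 h2 h3
    have := tri a b c h1 h2 h3
    simp only [hS] at this
    have e1 := this x
    have e2 := this z
    have e3 := this q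
    have e4 := this p
    clear this
    grind
  have F : ∀ a b c d, G.Adj a b → G.Adj b c → G.Adj c d → G.Adj d a → a ≠ c → b ≠ d →
      a = x ∨ a = z ∨ a = q ∨ a = p :=
    fun a b c d h1 h2 h3 h4 h5 h6 => (hS a).mp ((quad a b c d h1 h2 h3 h4 h5 h6 a).mpr (Or.inl rfl))
  let P : V → Prop := fun v => v ≠ z ∧ v ≠ p ∧ G.Adj x v
  let Q : V → Prop := fun v => v ≠ x ∧ v ≠ q ∧ G.Adj z v
  have dP : ∀ v, P v ↔ v ≠ z ∧ v ≠ p ∧ G.Adj x v := fun v => Iff.rfl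
  have dQ : ∀ v, Q v ↔ v ≠ x ∧ v ≠ q ∧ G.Adj z v := fun v => Iff.rfl
  clear_value P Q
  clear hS tri quad
  have z1 : ¬G.Adj x q := fun h => T x z q hxz hzq h.symm
  have z2 : ¬G.Adj z p := fun h => T x z p hxz h hpx
  have Px : ∀ v, P v → v ≠ x ∧ v ≠ q := by grind
  have Qz : ∀ v, Q v → v ≠ z ∧ v ≠ p := by grind
  have a1 : ∀ v, P v → ¬G.Adj v z := fun v h1 h2 => T v z x h2 hxz.symm ((dP v).mp h1).2.2
  have a2 : ∀ v, P v → ¬G.Adj v p := fun v h1 h2 => T v p x h2 hpx ((dP v).mp h1).2.2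
  have a2' : ∀ v, P v → ¬G.Adj v q := fun v h1 h2 => by
    have := F v q z x h2 hzq.symm hxz.symm ((dP v).mp h1).2.2 ((dP v).mp h1).1 n2.symm; grind
  have a3 : ∀ v v', P v → P v' → ¬G.Adj v v' := fun v v' h1 h2 h3 =>
    T v v' x h3 ((dP v').mp h2).2.2.symm ((dP v).mp h1).2.2
  have b1 : ∀ v, Q v → ¬G.Adj v x := fun v h1 h2 => T v x z h2 hxz ((dQ v).mp h1).2.2
  have b2 : ∀ v, Q v → ¬G.Adj v q := fun v h1 h2 => T v q z h2 hzq.symm ((dQ v).mp h1).2.2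
  have b2' : ∀ v, Q v → ¬G.Adj v p := fun v h1 h2 => by
    have := F v p x z h2 hpx hxz ((dQ v).mp h1).2.2 ((dQ v).mp h1).1 n5.symm; grind
  have b3 : ∀ v v', Q v → Q v' → ¬G.Adj v v' := fun v v' h1 h2 h3 =>
    T v v' z h3 ((dQ v').mp h2).2.2.symm ((dQ v).mp h1).2.2
  have c1 : ∀ v m, P v → Q m → ¬G.Adj v m := fun v m h1 h2 h3 => by
    have := F v m z x h3 ((dQ m).mp h2).2.2.symm hxz.symm ((dP v).mp h1).2.2
      ((dP v).mp h1).1 ((dQ m).mp h2).1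
    grind
  have c2 : ∀ v, P v → ¬Q v := fun v h1 h2 => a1 v h1 ((dQ v).mp h2).2.2.symm
  have cov : ∀ v, v = x ∨ v = z ∨ v = q ∨ v = p ∨ P v ∨ Q v := fun v => by
    have := hd.cases v; grind
  clear hd T F
  refine ⟨P, Q, ⟨⟨n1, n2, n3, n4, n5, n6⟩, by grind, by grind, cov, ?_, ?_, ?_, ?_, ?_, ?_⟩⟩
  · intro t; have := cov t; grind
  · intro t; have := cov t; grind
  · intro t; have := cov t; grind
  · intro t; have := cov t; grind
  · intro v hv t; have := cov t; grind
  · intro v hv t; have := cov t; grind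

/-- The alternatives of the classification. -/
def TransfersOrExceptional [Fintype V] (G : SimpleGraph V) : Prop :=
  Transfers G ∨ Nonempty (G ≃g H₁) ∨ Nonempty (G ≃g H₂) ∨ Nonempty (G ≃g H₃)

theorem none_or_one_or_two (P : V → Prop) :
    (P = fun _ => False) ∨ (∃ l, P l ∧ ∀ l', P l' → l' = l) ∨ ∃ l l', P l ∧ P l' ∧ l ≠ l' := by
  by_cases h : ∃ l, P l
  · obtain ⟨l, hl⟩ := h
    by_cases h' : ∀ l', P l' → l' = l
    · exact Or.inr (Or.inl ⟨l, hl, h'⟩)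
    · push Not at h'
      obtain ⟨l', h1, h2⟩ := h'
      exact Or.inr (Or.inr ⟨l', l, h1, hl, h2⟩)
  · left
    funext v
    simpa using fun hv => h ⟨v, hv⟩

variable [Fintype V]

theorem IsTriangleXZ.transfersOrExceptional {x z w : V} {P Q : V → Prop}
    (h : IsTriangleXZ G x z w P Q) : TransfersOrExceptional G := by
  rcases none_or_one_or_two P with rfl | ⟨l, hl, hu⟩ | ⟨l, l', hl, hl', hll⟩ <;>
  rcases none_or_one_or_two Q with rfl | ⟨m, hm, hv⟩ | ⟨m, m', hm, hm', hmm⟩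
  · exact Or.inl h.transfers_of_none
  · exact Or.inr (Or.inl (h.symm.nonempty_iso hm hv))
  · exact Or.inl (h.symm.transfers_of_two hm hm' hmm)
  · exact Or.inr (Or.inl (h.nonempty_iso hl hu))
  · exact Or.inl (h.transfers hl hm)
  · exact Or.inl (h.transfers hl hm)
  · exact Or.inl (h.transfers_of_two hl hl' hll)
  · exact Or.inl (h.transfers hl hm)
  · exact Or.inl (h.transfers hl hm)

theorem IsSquareXZ.transfersOrExceptional {x z q p : V} {P Q : V → Prop}
    (h : IsSquareXZ G x z q p P Q) : TransfersOrExceptional G := by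
  rcases none_or_one_or_two P with rfl | ⟨l, hl, hu⟩ | ⟨l, l', hl, hl', hll⟩
  · rcases none_or_one_or_two Q with rfl | ⟨m, hm, hv⟩ | ⟨m, m', hm, hm', hmm⟩
    · exact Or.inl h.transfers_of_none
    · exact Or.inr (Or.inr (Or.inl (h.symm.nonempty_iso_of_one hm hv)))
    · exact Or.inl (h.symm.transfers_of_two hm hm' hmm)
  · rcases none_or_one_or_two Q with rfl | ⟨m, hm, hv⟩ | ⟨m, m', hm, hm', hmm⟩
    · exact Or.inr (Or.inr (Or.inl (h.nonempty_iso_of_one hl hu)))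
    · exact Or.inr (Or.inr (Or.inr (h.nonempty_iso_of_one_one hl hu hm hv)))
    · exact Or.inl (h.symm.transfers_of_two hm hm' hmm)
  · exact Or.inl (h.transfers_of_two hl hl' hll)

/-- The path `x, p, q` determines the cycle: a triangle on `xz` if `q = z`, a triangle at `x` with
`z` outside it if `q` is adjacent to `x`, and a 4-cycle through `xz` if `q` is adjacent to `z`. -/
theorem transfersOrExceptional_of_dominates {S : V → Prop}
    (tri : ∀ a b c, G.Adj a b → G.Adj b c → G.Adj c a → ∀ v, S v ↔ v = a ∨ v = b ∨ v = c)
    (quad : ∀ a b c d, G.Adj a b → G.Adj b c → G.Adj c d → G.Adj d a → a ≠ c → b ≠ d →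
      ∀ v, S v ↔ v = a ∨ v = b ∨ v = c ∨ v = d)
    {x z p q : V} (hxz : G.Adj x z) (hd : Dominates G x z) (hpx : G.Adj x p) (hpz : p ≠ z)
    (hpq : G.Adj p q) (hqx : q ≠ x) : TransfersOrExceptional G := by
  by_cases hqz : q = z
  · subst hqz
    obtain ⟨P, Q, h⟩ := isTriangleXZ_of_dominates tri quad hxz hpx hpq.symm hd
    exact h.transfersOrExceptional
  rcases hd q hqx hqz with hq | hq
  · obtain ⟨P, h⟩ := isTailedTriangle_of_dominates tri quad hxz hpx hq hpq hpz.symm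
      (Ne.symm hqz) hd
    by_cases hm : ∃ m, m ≠ x ∧ G.Adj z m
    · obtain ⟨m, hm⟩ := hm
      exact Or.inl (h.transfers hm)
    · push Not at hm
      -- Here `z` is itself a pendant at `x`, so the triangle edge `xp` dominates too and the first
      -- case applies to it.
      have hd' : Dominates G x p := by
        intro s hs _
        by_cases hsz : s = z
        · exact Or.inl (hsz ▸ hxz)
        · exact Or.inl ((hd s hs hsz).resolve_right (hm s hs))
      obtain ⟨P, Q, h⟩ := isTriangleXZ_of_dominates tri quad hpx hq hpq hd'
      exact h.transfersOrExceptional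
  · obtain ⟨P, Q, h⟩ := isSquareXZ_of_dominates tri quad hxz hq hpq.symm hpx.symm
      hqx.symm hpz.symm hd
    exact h.transfersOrExceptional

theorem IsUnicyclic.transfersOrExceptional (hG : IsUnicyclic G) : TransfersOrExceptional G := by
  obtain ⟨S, tri, quad, ⟨v₀, h₀⟩, hS⟩ := hG.exists_cycle_verts
  by_cases hdom : ∀ u t, G.Adj u t → ¬Dominates G u t
  · exact Or.inl (transfers_of_not_dominates hdom)
  push Not at hdom
  obtain ⟨x, z, hxz, hd⟩ := hdom
  -- A vertex of the cycle has two distinct neighbours on it, so the cycle is not contained in `{x,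
  -- z}`.
  obtain ⟨v, hv, hvx, hvz⟩ : ∃ v, S v ∧ v ≠ x ∧ v ≠ z := by
    by_contra! hc
    replace hc : ∀ v, S v → v = x ∨ v = z := fun v hv => or_iff_not_imp_left.mpr (hc v hv)
    obtain ⟨a, b, ha, hb, hab, h1, h2⟩ := hS v₀ h₀
    have := h1.ne
    have := h2.ne
    have := hc a ha
    have := hc b hb
    have := hc v₀ h₀
    grind
  obtain ⟨a, b, -, -, hab, h1, h2⟩ := hS v hv
  rcases hd v hvx hvz with h3 | h3
  · obtain ⟨q, hq, hqx⟩ : ∃ q, G.Adj v q ∧ q ≠ x := by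
      by_cases h : a = x
      · exact ⟨b, h2, fun h' => hab (h.trans h'.symm)⟩
      · exact ⟨a, h1, h⟩
    exact transfersOrExceptional_of_dominates tri quad hxz hd h3 hvz hq hqx
  · have hd' : Dominates G z x := fun s h h' => (hd s h' h).symm
    obtain ⟨q, hq, hqz⟩ : ∃ q, G.Adj v q ∧ q ≠ z := by
      by_cases h : a = z
      · exact ⟨b, h2, fun h' => hab (h.trans h'.symm)⟩
      · exact ⟨a, h1, h⟩
    exact transfersOrExceptional_of_dominates tri quad hxz.symm hd' h3 hvx hq hqz

end
end FracDim

theorem mainTheorem5 {V : Type*} [Fintype V] (G : SimpleGraph V)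
    (hG : FracDim.IsUnicyclic G) (hV : 3 ≤ Fintype.card V) :
    ((Nonempty (G ≃g FracDim.H₁) ∨ Nonempty (G ≃g FracDim.H₂)) →
        FracDim.Sdf {G, Gᶜ} = FracDim.dimf G ∧
        FracDim.dimf G = FracDim.dimf Gᶜ + 1 / 2) ∧
    (Nonempty (G ≃g FracDim.H₃) →
        FracDim.Sdf {G, Gᶜ} = FracDim.dimf G ∧
        FracDim.dimf G = FracDim.dimf Gᶜ + 1 / 3) ∧
    (IsEmpty (G ≃g FracDim.H₁) → IsEmpty (G ≃g FracDim.H₂) → IsEmpty (G ≃g FracDim.H₃) →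
        FracDim.Sdf {G, Gᶜ} = FracDim.dimf Gᶜ) := by
  refine ⟨?_, ?_, ?_⟩
  · rintro (⟨⟨e⟩⟩ | ⟨⟨e⟩⟩)
    · rw [FracDim.Sdf_compl_iso e, FracDim.dimf_iso e, FracDim.dimf_iso (FracDim.complIso e)]
      refine ⟨FracDim.Sdf_H₁, ?_⟩
      rw [FracDim.dimf_H₁, FracDim.dimf_H₁_compl]
      norm_num
    · rw [FracDim.Sdf_compl_iso e, FracDim.dimf_iso e, FracDim.dimf_iso (FracDim.complIso e)]
      refine ⟨FracDim.Sdf_H₂, ?_⟩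
      rw [FracDim.dimf_H₂, FracDim.dimf_H₂_compl]
      norm_num
  · rintro ⟨e⟩
    rw [FracDim.Sdf_compl_iso e, FracDim.dimf_iso e, FracDim.dimf_iso (FracDim.complIso e)]
    refine ⟨FracDim.Sdf_H₃, ?_⟩
    rw [FracDim.dimf_H₃, FracDim.dimf_H₃_compl]
    norm_num
  · intro h₁ h₂ h₃
    rcases hG.transfersOrExceptional with h | h | h | h
    · exact h.Sdf_eq
    · exact (not_isEmpty_iff.mpr h h₁).elim
    · exact (not_isEmpty_iff.mpr h h₂).elim
    · exact (not_isEmpty_iff.mpr h h₃).elim
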